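/- Let $d\ge 2$, $\mathbb T^d=\mathbb R^d/\mathbb Z^d$, $p\in(1,\infty)$, $q\in(1,2)$, $q'=q/(q-1)$, $\gamma>0$, $\sigma\in[1,\infty]$, and assume that either $$\frac1p\Big(1+\frac\gamma\sigma\Big)+\frac1q-\frac1d<1,\qquad\text{or}\qquad \frac1p\Big(1+\frac\gamma\sigma\Big)+\frac1q-\frac1d=1\ \text{ and }\ q\ge\frac{2d}{d+2}.$$ Define $\beta$ by $\frac1\beta=\frac1p\big(1+\frac\gamma\sigma\big)$. Let $\nu:\mathbb R\to[0,\infty)$ be continuous, $g\in\mathbb R^d$, $\nu_*>0$, and let $(\rho,u,\pi)$ be a smooth solution on $[0,\infty)\times\mathbb T^d$ of $$\partial_t\rho+u\cdot\nabla\rho=0,\qquad -\operatorname{div}\big(\nu(\rho)|Du|^{p-2}Du\big)+\nabla\pi=\rho g,\qquad \operatorname{div}u=0,\qquad \int_{\mathbb T^d}u\,dx=0,$$ with initial datum $\rho(0)=\rho_0$, where $[Du]_{ij}=\frac12(\partial_iu_j+\partial_ju_i)$ and $|Du|$ is the Euclidean (Frobenius) norm. Here $\rho$, $u$ and $\pi$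 are smooth on $[0,\infty)\times\mathbb R^d$; $\rho$, $u$ and $\nabla\pi$ are $\mathbb Z^d$-periodic in $x$ (so $\pi$ may be periodic, or periodic plus a function affine in $x$); and the second equation holds on $\mathbb T^d$ in the sense of distributions for every $t\ge0$. Then $1<\beta<\infty$ and: 1. for all $t\ge 0$, $\ \|\rho(t)\|_{L^q}\le\|\rho_0\|_{L^q}$; 2. if $1/\rho_0\in L^\sigma(\mathbb T^d)$ and $\nu(r)\ge\nu_*|r|^\gamma$ for every value $r$ taken by $\rho_0$, then for all $t\ge0$ $$\|Du(t)\|_{L^\beta}\le C\,\|1/\rho_0\|_{L^\sigma}^{\frac{\gamma}{p-1}}\,\|\rho_0\|_{L^q}^{\frac1{p-1}};$$ 3. for all $t\ge0$, $\ \|u(t)\|_{L^{q'}}\le C_0\,\|Du(t)\|_{L^\beta}$. The constant $C_0$ depends only on $d,p,q,\gamma,\sigma$, and $C$ only on $d,p,q,\gamma,\sigma,\nu_*,g$. -/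

import Mathlib

open MeasureTheory
open scoped ContDiff ENNReal

noncomputable section

namespace StokesTransport

/-- The Euclidean space `ℝ^d`. Functions on the torus `𝕋^d = ℝ^d / ℤ^d` are represented by
`ℤ^d`-periodic functions on `ℝ^d`. -/
abbrev E (d : ℕ) : Type := EuclideanSpace ℝ (Fin d)

/-- The `i`-th vector of the canonical basis. -/
def e {d : ℕ} (i : Fin d) : E d := EuclideanSpace.single i 1

/-- `ℤ^d`-periodicity. -/
def Periodic {d : ℕ} {F : Type*} (f : E d → F) : Prop :=
  ∀ (x : E d) (i : Fin d), f (x + e i) = f x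

/-- Lebesgue measure on the fundamental domain `[0,1)^d`, that is, the measure of the torus.
The `L^r(𝕋^d)` norm of a periodic function `f` is `eLpNorm f r (torus d)`. -/
def torus (d : ℕ) : Measure (E d) :=
  volume.restrict {x : E d | ∀ i, x i ∈ Set.Ico (0 : ℝ) 1}

/-- The partial derivative `∂_i u_j` of a vector field. -/
def partialDeriv {d : ℕ} (u : E d → E d) (i j : Fin d) (x : E d) : ℝ :=
  (fderiv ℝ u x (e i)) j

/-- The divergence of a vector field. -/
def divergence {d : ℕ} (u : E d → E d) (x : E d) : ℝ := ∑ i, partialDeriv u i i x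

/-- The strain rate tensor `[Du]_{ij} = (∂_i u_j + ∂_j u_i) / 2`. -/
def strain {d : ℕ} (u : E d → E d) (x : E d) : Matrix (Fin d) (Fin d) ℝ :=
  Matrix.of fun i j => (partialDeriv u i j x + partialDeriv u j i x) / 2

/-- The scalar product `A : B` of matrices. -/
def contract {d : ℕ} (A B : Matrix (Fin d) (Fin d) ℝ) : ℝ := ∑ i, ∑ j, A i j * B i j

/-- The Euclidean (Frobenius) norm `|A|` of a matrix. -/
def matNorm {d : ℕ} (A : Matrix (Fin d) (Fin d) ℝ) : ℝ := Real.sqrt (contract A A)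

/-- The stress tensor `ν(ρ) |Du|^{p-2} Du` (equal to `0` where `Du = 0`, also if `p < 2`). -/
def stress {d : ℕ} (p : ℝ) (ν : ℝ → ℝ) (ρ : E d → ℝ) (u : E d → E d) (x : E d) :
    Matrix (Fin d) (Fin d) ℝ :=
  (ν (ρ x) * matNorm (strain u x) ^ (p - 2)) • strain u x

/-- Smoothness on `[0, ∞) × ℝ^d` of a time-dependent function. -/
def SmoothInTimeSpace {d : ℕ} {F : Type*} [NormedAddCommGroup F] [NormedSpace ℝ F]
    (f : ℝ → E d → F) : Prop :=
  ContDiffOn ℝ ∞ (fun z : ℝ × E d => f z.1 z.2) (Set.Ici (0 : ℝ) ×ˢ Set.univ)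

/-- The Stokes equation `- div (ν(ρ) |Du|^{p-2} Du) + ∇π = ρ g` on the torus, in the sense of
distributions: the stress of smooth fields need not be differentiable, because `ν` is merely
continuous and because of the power `p - 2`. -/
def StokesEq {d : ℕ} (p : ℝ) (ν : ℝ → ℝ) (g : E d) (ρ : E d → ℝ) (u : E d → E d)
    (π : E d → ℝ) : Prop :=
  ∀ φ : E d → E d, ContDiff ℝ ∞ φ → Periodic φ →
    (∫ x, contract (stress p ν ρ u x) (strain φ x) ∂(torus d))
        + ∫ x, fderiv ℝ π x (φ x) ∂(torus d)
      = ∫ x, ρ x * inner ℝ g (φ x) ∂(torus d)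

/-- `(ρ, u, π)` is a smooth solution on `[0, ∞) × 𝕋^d`, with initial datum `ρ₀`, of
`∂_t ρ + u · ∇ρ = 0`, `- div (ν(ρ) |Du|^{p-2} Du) + ∇π = ρ g`, `div u = 0`, with `u` of zero mean.
Only the gradient of the pressure has to be periodic, so that the pressure may contain a part
which is affine in `x` and balances the mean of `ρ g`. -/
structure IsSmoothSolution {d : ℕ} (p : ℝ) (ν : ℝ → ℝ) (g : E d) (ρ₀ : E d → ℝ)
    (ρ : ℝ → E d → ℝ) (u : ℝ → E d → E d) (π : ℝ → E d → ℝ) : Prop where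
  smooth_density : SmoothInTimeSpace ρ
  smooth_velocity : SmoothInTimeSpace u
  smooth_pressure : SmoothInTimeSpace π
  periodic_density : ∀ t, 0 ≤ t → Periodic (ρ t)
  periodic_velocity : ∀ t, 0 ≤ t → Periodic (u t)
  periodic_pressure_gradient : ∀ t, 0 ≤ t → Periodic (fderiv ℝ (π t))
  initial : ρ 0 = ρ₀
  transport : ∀ t, 0 < t → ∀ x,
    deriv (fun s => ρ s x) t + fderiv ℝ (ρ t) x (u t x) = 0
  stokes : ∀ t, 0 ≤ t → StokesEq p ν g (ρ t) (u t) (π t)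
  div_free : ∀ t, 0 ≤ t → ∀ x, divergence (u t) x = 0
  mean_zero : ∀ t, 0 ≤ t → ∫ x, u t x ∂(torus d) = 0

/-- The norm `‖1/ρ₀‖_{L^σ(𝕋^d)}`, where `1/ρ₀ = ∞` at the zeros of `ρ₀`. -/
def invNorm {d : ℕ} (ρ₀ : E d → ℝ) (σ : ℝ≥0∞) : ℝ≥0∞ :=
  eLpNorm (fun x => (‖ρ₀ x‖ₑ)⁻¹) σ (torus d)

end StokesTransport

end

open StokesTransport

namespace StokesTransport

open Set
open scoped Pointwise

variable {d : ℕ}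

/-! The density is transported by a divergence-free field, so its law on the torus never changes:
testing with $e^{is\rho}$ shows that the characteristic function of the law is constant in time
(`IsSmoothSolution.map_density`). Hence $\|\rho\|_{L^q}$ and $\|1/\rho\|_{L^\sigma}$ are conserved,
and the lower bound on $\nu$ holds at almost every value of $\rho(t)$.

The velocity bound is a Korn–Sobolev inequality proved without singular integrals. The difference
$D(z)=z\cdot(u(x+z)-u(x))$ is the integral over a segment of the quadratic form of $\nabla u$ in the
direction $z$, which sees only the strain. By periodicity $D(z+e_j)-D(z)=u_j(x+z)-u_j(x)$, whose
mean over $z$ is $-u_j(x)$. So $|u(x)|$ is bounded by averages of $|Du|(x+sz)$ over $s\in(0,1]$,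
$z\in[0,2)^d$ (`ofReal_norm_le`). These averages act like a Riesz potential of order one. The
corresponding Hardy–Littlewood–Sobolev inequality (`lintegral_segment_le`) follows from two bounds
on indicator functions, $|H||F|^{1/d}$ and $|F||H|^{1/d}$, each used on one side of a curve in the
plane of levels. Duality then gives `korn_sobolev` for $1/b=1+1/d-1/q$; both alternatives of the
hypothesis give $b\le\beta$.

For the strain, testing the Stokes equation with $u$ gives
$\int\nu(\rho)|Du|^p\le|g|\,\|\rho\|_{L^q}\|u\|_{L^{q'}}$ (`StokesEq.energy_le`). Hölder with the
weight $|\rho|^{-\gamma/p}$ bounds $\|Du\|_{L^\beta}$ by this energy (`eLpNorm_strain_le`). After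
Korn–Sobolev the right side contains $\|Du\|_{L^\beta}^{1/p}$, which is absorbed because $p>1$. -/

/-! ### Periodic functions and integration over the cell -/

/-- The fundamental cell of the torus. -/
def cell (d : ℕ) : Set (E d) := {x : E d | ∀ i, x i ∈ Ico (0 : ℝ) 1}

theorem torus_eq (d : ℕ) : torus d = volume.restrict (cell d) := rfl

/-- The box `[0, r)^d`. -/
def box (d : ℕ) (r : ℝ) : Set (E d) := {x : E d | ∀ i, x i ∈ Ico (0 : ℝ) r}

theorem measurableSet_box (d : ℕ) (r : ℝ) : MeasurableSet (box d r) := by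
  have : box d r = ⋂ i, (fun x : E d => x i) ⁻¹' Ico (0 : ℝ) r := by
    ext x; simp [box]
  rw [this]
  exact MeasurableSet.iInter fun i =>
    (EuclideanSpace.proj (𝕜 := ℝ) i).continuous.measurable measurableSet_Ico

theorem cell_eq_box (d : ℕ) : cell d = box d 1 := rfl

theorem measurableSet_cell (d : ℕ) : MeasurableSet (cell d) := measurableSet_box d 1

theorem volume_box (d : ℕ) {r : ℝ} : volume (box d r) = ENNReal.ofReal r ^ d := by
  have h := (EuclideanSpace.volume_preserving_symm_measurableEquiv_toLp (Fin d)).measure_preimage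
    (s := Set.pi univ fun _ => Ico (0 : ℝ) r)
    (MeasurableSet.univ_pi fun _ => measurableSet_Ico).nullMeasurableSet
  have h2 : box d r = (MeasurableEquiv.toLp 2 (Fin d → ℝ)).symm ⁻¹'
      (Set.pi univ fun _ => Ico (0 : ℝ) r) := by
    ext x; simp [box]
  rw [h2, h, volume_pi_pi]
  simp

instance : IsProbabilityMeasure (torus d) := by
  refine ⟨?_⟩
  rw [torus_eq, Measure.restrict_apply_univ, cell_eq_box, volume_box]
  simp

theorem norm_le_of_coord_le {x : E d} {r : ℝ} (h : ∀ i, |x i| ≤ r) :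
    ‖x‖ ≤ d * r := by
  have h1 : x = ∑ i, x i • (e i : E d) := by
    ext j
    simp [e, Pi.single_apply]
  calc ‖x‖ = ‖∑ i, x i • (e i : E d)‖ := by rw [← h1]
    _ ≤ ∑ i, ‖x i • (e i : E d)‖ := norm_sum_le _ _
    _ ≤ ∑ _i : Fin d, r := by
        refine Finset.sum_le_sum fun i _ => ?_
        simpa [norm_smul, e] using h i
    _ = d * r := by simp

theorem box_subset_closedBall (d : ℕ) (r : ℝ) :
    box d r ⊆ Metric.closedBall 0 (d * r) := by
  intro x hx
  rw [mem_closedBall_zero_iff]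
  exact norm_le_of_coord_le fun i => by
    rw [abs_of_nonneg (hx i).1]; exact (hx i).2.le

theorem sum_coord_smul_e (x : E d) : ∑ i, x i • (e i : E d) = x := by
  ext j
  simp [e, Pi.single_apply]

theorem _root_.Continuous.integrable_torus {V : Type*} [NormedAddCommGroup V] {f : E d → V}
    (hf : Continuous f) : Integrable f (torus d) := by
  have h := (hf.locallyIntegrable (μ := (volume : Measure (E d)))).integrableOn_isCompact
    (isCompact_closedBall (0 : E d) (d * 1))
  exact h.mono_set (box_subset_closedBall d 1)

/-- The periods of `f` form a subgroup, and it contains the basis of the lattice. -/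
theorem Periodic.vadd {F : Type*} {f : E d → F} (hf : Periodic f)
    {g : E d} (hg : g ∈ Submodule.span ℤ (range (EuclideanSpace.basisFun (Fin d) ℝ).toBasis))
    (x : E d) : f (g + x) = f x := by
  let S : AddSubgroup (E d) :=
    { carrier := {g | ∀ x, f (g + x) = f x}
      zero_mem' := fun x => by simp
      add_mem' := fun {a b} ha hb x => by
        rw [add_assoc, ha, hb]
      neg_mem' := fun {a} ha x => by
        rw [← ha (-a + x), add_neg_cancel_left] }
  have : Submodule.span ℤ (range (EuclideanSpace.basisFun (Fin d) ℝ).toBasis) ≤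
      AddSubgroup.toIntSubmodule S := by
    rw [Submodule.span_le]
    rintro _ ⟨i, rfl⟩ x
    rw [add_comm]
    simpa [e] using hf x i
  exact this hg x

theorem cell_eq_fundamentalDomain (d : ℕ) :
    cell d = ZSpan.fundamentalDomain (EuclideanSpace.basisFun (Fin d) ℝ).toBasis := by
  ext x
  simp [cell, ZSpan.mem_fundamentalDomain]

/-- Any two fundamental domains of the lattice give a periodic function the same integral; applied
to the cell and its translates, this yields translation invariance on the torus. -/
theorem isAddFundamentalDomain_vadd_cell (a : E d) : IsAddFundamentalDomain
    (Submodule.span ℤ (range (EuclideanSpace.basisFun (Fin d) ℝ).toBasis)).toAddSubgroup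
    (a +ᵥ cell d)
    (volume : Measure (E d)) := by
  rw [cell_eq_fundamentalDomain]
  exact (ZSpan.isAddFundamentalDomain' _ _).vadd_of_comm a

theorem Periodic.lintegral_add_right {f : E d → ℝ≥0∞} (hf : Periodic f) (a : E d) :
    ∫⁻ x, f (x + a) ∂(torus d) = ∫⁻ x, f x ∂(torus d) := by
  have : Countable
      (Submodule.span ℤ (range (EuclideanSpace.basisFun (Fin d) ℝ).toBasis)).toAddSubgroup :=
    inferInstanceAs
      (Countable (Submodule.span ℤ (range (EuclideanSpace.basisFun (Fin d) ℝ).toBasis)))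
  have h0 := isAddFundamentalDomain_vadd_cell (0 : E d)
  rw [zero_vadd] at h0
  have h := (isAddFundamentalDomain_vadd_cell a).setLIntegral_eq h0 f
    fun g x => hf.vadd g.2 x
  rw [torus_eq, ← h]
  have hp := (measurePreserving_add_right (volume : Measure (E d)) a)
  have hi : a +ᵥ cell d = (fun x => x + a) '' cell d := by
    ext x; simp only [mem_vadd_set, mem_image, vadd_eq_add, add_comm a]
  rw [hi, hp.setLIntegral_comp_emb (measurableEmbedding_addRight a)]

theorem Periodic.integral_add_right {V : Type*} [NormedAddCommGroup V] [NormedSpace ℝ V]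
    {f : E d → V} (hf : Periodic f) (a : E d) :
    ∫ x, f (x + a) ∂(torus d) = ∫ x, f x ∂(torus d) := by
  have : Countable
      (Submodule.span ℤ (range (EuclideanSpace.basisFun (Fin d) ℝ).toBasis)).toAddSubgroup :=
    inferInstanceAs
      (Countable (Submodule.span ℤ (range (EuclideanSpace.basisFun (Fin d) ℝ).toBasis)))
  have h0 := isAddFundamentalDomain_vadd_cell (0 : E d)
  rw [zero_vadd] at h0
  have h := (isAddFundamentalDomain_vadd_cell a).setIntegral_eq h0 (f := f)
    fun g x => hf.vadd g.2 x
  rw [torus_eq, ← h]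
  have hp := (measurePreserving_add_right (volume : Measure (E d)) a)
  have hi : a +ᵥ cell d = (fun x => x + a) '' cell d := by
    ext x; simp only [mem_vadd_set, mem_image, vadd_eq_add, add_comm a]
  rw [hi, hp.setIntegral_image_emb (measurableEmbedding_addRight a)]

/-- The integral of a periodic function over `[0, n)^d` is at most `n^d` times that over the
fundamental cell. -/
theorem Periodic.lintegral_box_le {f : E d → ℝ≥0∞} (hf : Periodic f) (n : ℕ) :
    ∫⁻ x in box d n, f x ≤ (n : ℝ≥0∞) ^ d * ∫⁻ x, f x ∂(torus d) := by
  let v : (Fin d → Fin n) → E d := fun k => WithLp.toLp 2 fun i => ((k i : ℕ) : ℝ)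
  -- Integer parts of the coordinates select the unit cell containing a point.
  have hcov : box d n ⊆ ⋃ k, (fun x => x + v k) '' cell d := by
    intro x hx
    have hfl : ∀ i, ⌊x i⌋₊ < n := fun i => (Nat.floor_lt (hx i).1).2 (hx i).2
    refine mem_iUnion.2 ⟨fun i => ⟨⌊x i⌋₊, hfl i⟩, x - v _, ?_, sub_add_cancel _ _⟩
    intro i
    have h1 := Nat.floor_le (hx i).1
    have h2 := Nat.lt_floor_add_one (x i)
    constructor <;> simp [v] <;> linarith
  have hk : ∀ k, ∫⁻ x in (fun x => x + v k) '' cell d, f x = ∫⁻ x, f x ∂(torus d) := by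
    intro k
    rw [← hf.lintegral_add_right (v k), torus_eq,
      (measurePreserving_add_right (volume : Measure (E d)) (v k)).setLIntegral_comp_emb
        (measurableEmbedding_addRight (v k))]
  calc ∫⁻ x in box d n, f x ≤ ∫⁻ x in ⋃ k, (fun x => x + v k) '' cell d, f x :=
        lintegral_mono_set hcov
    _ ≤ ∑' k, ∫⁻ x in (fun x => x + v k) '' cell d, f x := lintegral_iUnion_le _ _
    _ = (n : ℝ≥0∞) ^ d * ∫⁻ x, f x ∂(torus d) := by
        simp only [hk]
        rw [tsum_fintype]
        simp

/-! ### Integration by parts on the torus -/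

/-- The segment integral of a directional derivative. -/
theorem integral_fderiv_segment {V : Type*} [NormedAddCommGroup V] [NormedSpace ℝ V]
    [CompleteSpace V] {F : E d → V} (hF : ContDiff ℝ 1 F) (x z : E d) :
    ∫ s in (0 : ℝ)..1, fderiv ℝ F (x + s • z) z = F (x + z) - F x := by
  have hd : ∀ s : ℝ, HasDerivAt (fun s : ℝ => F (x + s • z)) (fderiv ℝ F (x + s • z) z) s := by
    intro s
    have h1 : HasDerivAt (fun s : ℝ => x + s • z) z s := by
      simpa using ((hasDerivAt_id s).smul_const z).const_add x
    exact ((hF.differentiable one_ne_zero) (x + s • z)).hasFDerivAt.comp_hasDerivAt s h1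
  have hc : Continuous fun s : ℝ => fderiv ℝ F (x + s • z) z := by
    have := hF.continuous_fderiv one_ne_zero
    fun_prop
  rw [intervalIntegral.integral_eq_sub_of_hasDerivAt (fun s _ => hd s) (hc.intervalIntegrable 0 1)]
  simp

theorem integrable_Ioc_prod_torus {V : Type*} [NormedAddCommGroup V]
    {f : ℝ → E d → V} {a b : ℝ}
    (hf : ContinuousOn (Function.uncurry f) (Icc a b ×ˢ univ)) :
    Integrable (Function.uncurry f) ((volume.restrict (Ioc a b)).prod (torus d)) := by
  rw [torus_eq, Measure.prod_restrict]
  have hK : IsCompact (Icc a b ×ˢ Metric.closedBall (0 : E d) (d * 1)) :=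
    isCompact_Icc.prod (isCompact_closedBall _ _)
  have h := (hf.mono (prod_mono_right (subset_univ _))).integrableOn_compact
    (μ := (volume : Measure ℝ).prod (volume : Measure (E d))) hK
  exact h.mono_set (prod_mono Ioc_subset_Icc_self (box_subset_closedBall d 1))

/-- The integral over the torus of a derivative of a periodic function vanishes. -/
theorem Periodic.integral_fderiv_e {V : Type*} [NormedAddCommGroup V] [NormedSpace ℝ V]
    [CompleteSpace V] {F : E d → V} (hF : ContDiff ℝ 1 F) (hp : Periodic F) (i : Fin d) :
    ∫ x, fderiv ℝ F x (e i) ∂(torus d) = 0 := by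
  have hF' := hF.continuous_fderiv one_ne_zero
  have hp' : Periodic fun x => fderiv ℝ F x (e i) := by
    intro x j
    have : (fun y => F (y + e j)) = F := funext fun y => hp y j
    have h2 : fderiv ℝ F (x + e j) = fderiv ℝ F x := by
      rw [← fderiv_comp_add_right (e j), this]
    simp only [h2]
  -- Along a full period the derivative integrates to zero. Integrating this in `x` and exchanging
  -- the integrals gives the claim, since each shift by `s • e i` leaves the torus integral
  -- unchanged.
  have h1 : ∀ x, ∫ s in (0 : ℝ)..1, fderiv ℝ F (x + s • e i) (e i) = 0 := fun x => by
    rw [integral_fderiv_segment hF, hp, sub_self]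
  have hint := integrable_Ioc_prod_torus (a := 0) (b := 1) (V := V)
    (f := fun s (x : E d) => fderiv ℝ F (x + s • e i) (e i)) (by
      apply Continuous.continuousOn
      simp only [Function.uncurry_def]
      fun_prop)
  have hswap := integral_integral_swap hint
  simp only [intervalIntegral.integral_of_le zero_le_one] at h1
  simp only [h1, integral_zero] at hswap
  have h3 : ∀ s : ℝ, ∫ x, fderiv ℝ F (x + s • e i) (e i) ∂(torus d) =
      ∫ x, fderiv ℝ F x (e i) ∂(torus d) := fun s => hp'.integral_add_right (s • e i)
  simpa [h3] using hswap

/-- A divergence-free periodic field is orthogonal to gradients of periodic functions. -/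
theorem integral_fderiv_divFree {V : Type*} [NormedAddCommGroup V] [NormedSpace ℝ V]
    [CompleteSpace V] {w : E d → V} {u : E d → E d} (hw : ContDiff ℝ 1 w) (hu : ContDiff ℝ 1 u)
    (pw : Periodic w) (pu : Periodic u) (hdiv : ∀ x, divergence u x = 0) :
    ∫ x, fderiv ℝ w x (u x) ∂(torus d) = 0 := by
  have hui : ∀ i, ContDiff ℝ 1 fun x => u x i := fun i =>
    (EuclideanSpace.proj (𝕜 := ℝ) i).contDiff.comp hu
  have hdi : ∀ i x, fderiv ℝ (fun x => u x i) x (e i) = partialDeriv u i i x := by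
    intro i x
    have := ((EuclideanSpace.proj (𝕜 := ℝ) i).hasFDerivAt.comp x
      ((hu.differentiable one_ne_zero) x).hasFDerivAt).fderiv
    have h2 : (fun x => u x i) = (EuclideanSpace.proj (𝕜 := ℝ) i) ∘ u := rfl
    rw [h2, this]
    rfl
  -- Divergence form: $u\cdot\nabla w=\sum_i\partial_i(u_iw)$, because $\operatorname{div}u=0$.
  have key : ∀ x, fderiv ℝ w x (u x) = ∑ i, fderiv ℝ (fun x => u x i • w x) x (e i) := by
    intro x
    have h1 : ∀ i, fderiv ℝ (fun x => u x i • w x) x (e i) =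
        u x i • fderiv ℝ w x (e i) + partialDeriv u i i x • w x := by
      intro i
      rw [fderiv_fun_smul (((hui i).differentiable one_ne_zero) x)
        ((hw.differentiable one_ne_zero) x), ← hdi i x]
      simp
    simp only [h1, Finset.sum_add_distrib, ← Finset.sum_smul]
    have h2 : ∑ i, partialDeriv u i i x = 0 := hdiv x
    rw [h2, zero_smul, add_zero]
    conv_lhs => rw [← sum_coord_smul_e (u x)]
    simp
  have hc : ∀ i, ContDiff ℝ 1 fun x => u x i • w x := fun i => (hui i).smul hw
  simp only [key]
  rw [integral_finsetSum]
  · refine Finset.sum_eq_zero fun i _ => ?_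
    refine Periodic.integral_fderiv_e (hc i) (fun x j => ?_) i
    simp only [pu x j, pw x j]
  · intro i _
    have := (hc i).continuous_fderiv one_ne_zero
    exact Continuous.integrable_torus (by fun_prop)

/-! ### A bilinear estimate from superlevel sets -/

/-- Double layer cake formula. -/
theorem lintegral_mul_eq_lintegral_lintegral_meas {Ω : Type*} [MeasurableSpace Ω] (m : Measure Ω)
    {f h : Ω → ℝ} (hf : Measurable f) (hh : Measurable h) (f0 : ∀ x, 0 ≤ f x) (h0 : ∀ x, 0 ≤ h x) :
    ∫⁻ x, ENNReal.ofReal (h x) * ENNReal.ofReal (f x) ∂m =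
      ∫⁻ a in Ioi (0 : ℝ), ∫⁻ b in Ioi (0 : ℝ), m ({x | b < h x} ∩ {x | a < f x}) := by
  have hm : Measurable fun x => ENNReal.ofReal (h x) := hh.ennreal_ofReal
  -- Taking `h` as a density reduces the product to two successive uses of the one-function layer
  -- cake formula.
  have h1 : ∫⁻ x, ENNReal.ofReal (h x) * ENNReal.ofReal (f x) ∂m =
      ∫⁻ x, ENNReal.ofReal (f x) ∂(m.withDensity fun x => ENNReal.ofReal (h x)) := by
    rw [lintegral_withDensity_eq_lintegral_mul _ hm hf.ennreal_ofReal]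
    rfl
  rw [h1, lintegral_eq_lintegral_meas_lt _ (Filter.Eventually.of_forall f0) hf.aemeasurable]
  refine lintegral_congr fun a => ?_
  have ha : MeasurableSet {x | a < f x} := measurableSet_lt measurable_const hf
  rw [withDensity_apply _ ha,
    lintegral_eq_lintegral_meas_lt _ (Filter.Eventually.of_forall h0) hh.aemeasurable]
  refine lintegral_congr fun b => ?_
  rw [Measure.restrict_apply (measurableSet_lt measurable_const hh)]

/-- `∫_0^A H^θ` is controlled by the moment `∫ H b^{q-1}`. -/
theorem lintegral_rpow_Ioc_le {θ q : ℝ} (hθ : 0 < θ) (hθ1 : θ < 1) (hqθ : q * θ < 1)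
    {H : ℝ → ℝ≥0∞} (hH : Measurable H)
    (h1 : ∫⁻ b in Ioi (0 : ℝ), H b * ENNReal.ofReal (b ^ (q - 1)) ≤ 1) {A : ℝ} (hA : 0 < A) :
    ∫⁻ b in Ioc 0 A, H b ^ θ ≤
      ENNReal.ofReal (((1 - θ) / (1 - q * θ)) ^ (1 - θ)) * ENNReal.ofReal (A ^ (1 - q * θ)) := by
  have hconj : (1 / θ).HolderConjugate (1 / (1 - θ)) := by
    rw [Real.holderConjugate_iff]
    refine ⟨by rw [lt_div_iff₀ hθ]; linarith, ?_⟩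
    simp
  set r : ℝ := (q - 1) * θ with hr
  have hr1 : -1 < -(r / (1 - θ)) := by
    rw [neg_lt_neg_iff, div_lt_one (by linarith)]; nlinarith
  -- Hölder with exponents $1/\theta$ and $1/(1-\theta)$: the first factor reproduces the moment of
  -- `H`, and the power left over is integrable at $0$ exactly because $q\theta<1$.
  have hb : ∀ b ∈ Ioc 0 A, H b ^ θ =
      (H b * ENNReal.ofReal (b ^ (q - 1))) ^ θ * ENNReal.ofReal (b ^ (-r)) := by
    intro b hb
    rw [ENNReal.mul_rpow_of_nonneg _ _ hθ.le, ENNReal.ofReal_rpow_of_pos (Real.rpow_pos_of_pos hb.1 _),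
      mul_assoc, ← ENNReal.ofReal_mul (by have := hb.1; positivity), ← Real.rpow_mul hb.1.le, ← hr,
      ← Real.rpow_add hb.1]
    simp
  rw [setLIntegral_congr_fun measurableSet_Ioc hb]
  refine (ENNReal.lintegral_mul_le_Lp_mul_Lq _ hconj (by fun_prop) (by fun_prop)).trans ?_
  have e1 : ∀ b, ((H b * ENNReal.ofReal (b ^ (q - 1))) ^ θ) ^ (1 / θ) =
      H b * ENNReal.ofReal (b ^ (q - 1)) := fun b => by
    rw [← ENNReal.rpow_mul, mul_one_div_cancel hθ.ne', ENNReal.rpow_one]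
  have e2 : ∫⁻ b in Ioc 0 A, ENNReal.ofReal (b ^ (-r)) ^ (1 / (1 - θ)) =
      ENNReal.ofReal (A ^ (-(r / (1 - θ)) + 1) / (-(r / (1 - θ)) + 1)) := by
    have : ∀ b ∈ Ioc 0 A, ENNReal.ofReal (b ^ (-r)) ^ (1 / (1 - θ)) =
        ENNReal.ofReal (b ^ (-(r / (1 - θ)))) := fun b hb => by
      rw [ENNReal.ofReal_rpow_of_pos (Real.rpow_pos_of_pos hb.1 _), ← Real.rpow_mul hb.1.le]
      congr 2; ring
    rw [setLIntegral_congr_fun measurableSet_Ioc this, ← ofReal_integral_eq_lintegral_ofReal,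
      ← intervalIntegral.integral_of_le hA.le, integral_rpow (Or.inl hr1)]
    · rw [Real.zero_rpow (by linarith), sub_zero]
    · have := intervalIntegral.intervalIntegrable_rpow' (a := 0) (b := A) hr1
      rwa [intervalIntegrable_iff_integrableOn_Ioc_of_le hA.le] at this
    · filter_upwards [ae_restrict_mem measurableSet_Ioc] with b hb
      exact Real.rpow_nonneg hb.1.le _
  simp only [e1, e2, one_div_one_div]
  have e3 : (∫⁻ b in Ioc 0 A, H b * ENNReal.ofReal (b ^ (q - 1))) ^ θ ≤ 1 :=
    ENNReal.rpow_le_one ((lintegral_mono_set Ioc_subset_Ioi_self).trans h1) hθ.le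
  have h1θ : 0 < 1 - θ := by linarith
  have h1q : 0 < 1 - q * θ := by linarith
  have e4 : -(r / (1 - θ)) + 1 = (1 - q * θ) / (1 - θ) := by
    rw [hr]; field_simp; ring
  refine (mul_le_mul_left e3 _).trans ?_
  rw [one_mul, e4, ENNReal.ofReal_rpow_of_pos (by positivity), ← ENNReal.ofReal_mul (by positivity)]
  apply le_of_eq
  congr 1
  rw [Real.div_rpow (by positivity) (by positivity), ← Real.rpow_mul hA.le,
    div_mul_cancel₀ _ h1θ.ne', Real.div_rpow h1θ.le h1q.le, Real.div_rpow h1q.le h1θ.le]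
  field_simp

/-- With $A=a^{\beta/q}$ the inner integral is at most a constant times $A^{1-q\theta}$, and the
scaling relation `hs` turns this power into $a^{\beta-1}$, the weight in the moment of `F`.
Exchanging the two functions treats the region beyond the curve. -/
theorem lintegral_mul_lintegral_rpow_le {θ β q : ℝ} (hθ : 0 < θ) (hθ1 : θ < 1) (hβ : 1 < β) (hq : 1 < q)
    (hs : 1 / β + 1 / q = 1 + θ) {F H : ℝ → ℝ≥0∞} (hH : Measurable H) (hF : Measurable F)
    (hF1 : ∫⁻ b in Ioi (0 : ℝ), F b * ENNReal.ofReal (b ^ (β - 1)) ≤ 1)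
    (hH1 : ∫⁻ b in Ioi (0 : ℝ), H b * ENNReal.ofReal (b ^ (q - 1)) ≤ 1) :
    ∫⁻ a in Ioi (0 : ℝ), F a * ∫⁻ b in Ioc 0 (a ^ (β / q)), H b ^ θ ≤
      ENNReal.ofReal (((1 - θ) / (1 - q * θ)) ^ (1 - θ)) := by
  have hβ0 : 0 < β := by linarith
  have hq0 : 0 < q := by linarith
  have hqθ : q * θ < 1 := by
    have h1 : 1 / β < 1 := by rw [div_lt_one hβ0]; exact hβ
    have h2 : θ < 1 / q := by linarith
    rw [lt_div_iff₀ hq0] at h2; linarith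
  set K := ENNReal.ofReal (((1 - θ) / (1 - q * θ)) ^ (1 - θ))
  calc ∫⁻ a in Ioi (0 : ℝ), F a * ∫⁻ b in Ioc 0 (a ^ (β / q)), H b ^ θ
      ≤ ∫⁻ a in Ioi (0 : ℝ), K * (F a * ENNReal.ofReal (a ^ (β - 1))) := by
        refine setLIntegral_mono (by fun_prop) fun a ha => ?_
        have ha : 0 < a := ha
        have h := lintegral_rpow_Ioc_le hθ hθ1 hqθ hH hH1 (Real.rpow_pos_of_pos ha (β / q))
        rw [← Real.rpow_mul ha.le] at h
        have he : β / q * (1 - q * θ) = β - 1 := by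
          have : θ = 1 / β + 1 / q - 1 := by linarith
          rw [this]; field_simp; ring
        rw [he] at h
        calc F a * _ ≤ F a * (K * ENNReal.ofReal (a ^ (β - 1))) := mul_le_mul_right h _
          _ = _ := by ring
    _ = K * ∫⁻ a in Ioi (0 : ℝ), F a * ENNReal.ofReal (a ^ (β - 1)) :=
        lintegral_const_mul _ (by fun_prop)
    _ ≤ K * 1 := mul_le_mul_right hF1 _
    _ = K := mul_one _

/-- The constant in the bilinear estimate. -/
noncomputable def bilinearConst (θ β q : ℝ) : ℝ≥0∞ :=
  ENNReal.ofReal (((1 - θ) / (1 - q * θ)) ^ (1 - θ)) +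
    ENNReal.ofReal (((1 - θ) / (1 - β * θ)) ^ (1 - θ))

/-- A bilinear estimate of Hardy-Littlewood-Sobolev type, obtained from restricted bounds on
superlevel sets. -/
theorem lintegral_mul_le_of_superlevel {Ω : Type*} [MeasurableSpace Ω] (m : Measure Ω)
    {f h : Ω → ℝ} (hf : Measurable f) (hh : Measurable h) (f0 : ∀ x, 0 ≤ f x) (h0 : ∀ x, 0 ≤ h x)
    {θ β q : ℝ} (hθ : 0 < θ) (hθ1 : θ < 1) (hβ : 1 < β) (hq : 1 < q)
    (hs : 1 / β + 1 / q = 1 + θ) {F H : ℝ → ℝ≥0∞} (hH : Measurable H) (hF : Measurable F)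
    (hF1 : ∫⁻ b in Ioi (0 : ℝ), F b * ENNReal.ofReal (b ^ (β - 1)) ≤ 1)
    (hH1 : ∫⁻ b in Ioi (0 : ℝ), H b * ENNReal.ofReal (b ^ (q - 1)) ≤ 1) {M : ℝ≥0∞} (hM : M ≠ ⊤)
    (hm1 : ∀ a b, 0 < a → 0 < b →
      m ({x | b < h x} ∩ {x | a < f x}) ≤ M * (F a * H b ^ θ))
    (hm2 : ∀ a b, 0 < a → 0 < b →
      m ({x | b < h x} ∩ {x | a < f x}) ≤ M * (H b * F a ^ θ)) :
    ∫⁻ x, ENNReal.ofReal (h x) * ENNReal.ofReal (f x) ∂m ≤ M * bilinearConst θ β q := by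
  have hβ0 : 0 < β := by linarith
  have hq0 : 0 < q := by linarith
  rw [lintegral_mul_eq_lintegral_lintegral_meas m hf hh f0 h0]
  have hS : MeasurableSet {z : ℝ × ℝ | z.2 ≤ z.1 ^ (β / q)} :=
    measurableSet_le measurable_snd (by fun_prop)
  -- The quadrant of levels is cut along $b=a^{\beta/q}$, the curve respecting the normalizations
  -- $\int f^\beta$ and $\int h^q$. Below it `hm1` is used, above it `hm2`.
  let G1 : ℝ → ℝ → ℝ≥0∞ := fun a b => (Iic (a ^ (β / q))).indicator (fun b => F a * H b ^ θ) b
  let G2 : ℝ → ℝ → ℝ≥0∞ := fun a b => (Ioi (a ^ (β / q))).indicator (fun b => H b * F a ^ θ) b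
  have mG1 : Measurable (Function.uncurry G1) := by
    have : Function.uncurry G1 = {z : ℝ × ℝ | z.2 ≤ z.1 ^ (β / q)}.indicator
        fun z => F z.1 * H z.2 ^ θ := by
      ext ⟨a, b⟩; simp [G1, indicator, Function.uncurry]
    rw [this]
    exact Measurable.indicator (by fun_prop) hS
  have mG2 : Measurable (Function.uncurry G2) := by
    have : Function.uncurry G2 = {z : ℝ × ℝ | z.2 ≤ z.1 ^ (β / q)}ᶜ.indicator
        fun z => H z.2 * F z.1 ^ θ := by
      ext ⟨a, b⟩; simp [G2, indicator, Function.uncurry]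
    rw [this]
    exact Measurable.indicator (by fun_prop) hS.compl
  have hle : ∀ a ∈ Ioi (0 : ℝ), ∫⁻ b in Ioi (0 : ℝ), m ({x | b < h x} ∩ {x | a < f x}) ≤
      ∫⁻ b in Ioi (0 : ℝ), M * (G1 a b + G2 a b) := by
    intro a ha
    refine setLIntegral_mono ?_ fun b hb => ?_
    · have h1 : Measurable (G1 a) := mG1.of_uncurry_left
      have h2 : Measurable (G2 a) := mG2.of_uncurry_left
      fun_prop
    · by_cases hab : b ≤ a ^ (β / q)
      · have : G1 a b = F a * H b ^ θ := indicator_of_mem (by exact hab) _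
        exact (hm1 a b ha hb).trans (mul_le_mul_right (this ▸ le_self_add) _)
      · have : G2 a b = H b * F a ^ θ := indicator_of_mem (by simpa using hab) _
        exact (hm2 a b ha hb).trans (mul_le_mul_right (this ▸ le_add_self) _)
  have mI1 : Measurable fun a => ∫⁻ b in Ioi (0 : ℝ), G1 a b := mG1.lintegral_prod_right'
  have mI2 : Measurable fun a => ∫⁻ b in Ioi (0 : ℝ), G2 a b := mG2.lintegral_prod_right'
  have hsplit : ∀ a, ∫⁻ b in Ioi (0 : ℝ), M * (G1 a b + G2 a b) =
      M * (∫⁻ b in Ioi (0 : ℝ), G1 a b) + M * ∫⁻ b in Ioi (0 : ℝ), G2 a b := fun a => by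
    have h1 : Measurable (G1 a) := mG1.of_uncurry_left
    rw [lintegral_const_mul' _ _ hM, lintegral_add_left h1, mul_add]
  have hG1 : ∫⁻ a in Ioi (0 : ℝ), ∫⁻ b in Ioi (0 : ℝ), G1 a b ≤
      ENNReal.ofReal (((1 - θ) / (1 - q * θ)) ^ (1 - θ)) := by
    refine le_trans (le_of_eq ?_) (lintegral_mul_lintegral_rpow_le hθ hθ1 hβ hq hs hH hF hF1 hH1)
    refine lintegral_congr fun a => ?_
    rw [← lintegral_const_mul _ (by fun_prop)]
    simp only [G1]
    rw [lintegral_indicator measurableSet_Iic, Measure.restrict_restrict measurableSet_Iic,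
      Iic_inter_Ioi]
  have hG2 : ∫⁻ a in Ioi (0 : ℝ), ∫⁻ b in Ioi (0 : ℝ), G2 a b ≤
      ENNReal.ofReal (((1 - θ) / (1 - β * θ)) ^ (1 - θ)) := by
    rw [lintegral_lintegral_swap mG2.aemeasurable]
    refine le_trans ?_ (lintegral_mul_lintegral_rpow_le hθ hθ1 hq hβ (by linarith) hF hH hH1 hF1)
    refine setLIntegral_mono' measurableSet_Ioi fun b hb => ?_
    have hb : 0 < b := hb
    rw [← lintegral_const_mul _ (by fun_prop),
      ← lintegral_indicator measurableSet_Ioc, ← lintegral_indicator measurableSet_Ioi]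
    refine lintegral_mono fun a => ?_
    by_cases ha : a ∈ Ioi (0 : ℝ)
    · have ha' : 0 < a := ha
      rw [indicator_of_mem ha]
      by_cases hab : b ∈ Ioi (a ^ (β / q))
      · have : a ∈ Ioc 0 (b ^ (q / β)) := by
          refine ⟨ha, ?_⟩
          have h1 := Real.rpow_le_rpow (by positivity) (le_of_lt hab) (by positivity : 0 ≤ q / β)
          rwa [← Real.rpow_mul ha'.le, div_mul_div_cancel₀ hq0.ne', div_self hβ0.ne',
            Real.rpow_one] at h1
        rw [indicator_of_mem this]
        simp only [G2, indicator_of_mem hab, le_refl]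
      · simp only [G2, indicator_of_notMem hab]; exact bot_le
    · rw [indicator_of_notMem ha]; exact bot_le
  calc _ ≤ ∫⁻ a in Ioi (0 : ℝ),
        (M * (∫⁻ b in Ioi (0 : ℝ), G1 a b) + M * ∫⁻ b in Ioi (0 : ℝ), G2 a b) :=
        setLIntegral_mono (by fun_prop) fun a ha => (hle a ha).trans (hsplit a).le
    _ = M * (∫⁻ a in Ioi (0 : ℝ), ∫⁻ b in Ioi (0 : ℝ), G1 a b) +
        M * ∫⁻ a in Ioi (0 : ℝ), ∫⁻ b in Ioi (0 : ℝ), G2 a b := by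
        rw [lintegral_add_left (by fun_prop), lintegral_const_mul' _ _ hM,
          lintegral_const_mul' _ _ hM]
    _ ≤ M * bilinearConst θ β q := by
        rw [bilinearConst, mul_add]
        exact add_le_add (mul_le_mul_right hG1 _) (mul_le_mul_right hG2 _)

/-! ### Hardy–Littlewood–Sobolev inequality for segment averages -/

/-- The bounds $V$ and $s^{-d}VF$ cross at $\delta=F^{1/d}$. Below $\delta$ the first contributes
$BV\delta$; above it $\int_\delta^\infty s^{-d}\,ds\le\delta^{1-d}$, where $d\ge2$ makes the factor
$1/(d-1)$ at most one, and $F\delta^{1-d}=\delta$. -/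
theorem lintegral_min_scaling_le {d : ℕ} (hd : 2 ≤ d) {J : ℝ → ℝ≥0∞} {B V F : ℝ≥0∞}
    (h1 : ∀ s ∈ Ioc (0 : ℝ) 1, J s ≤ B * V)
    (h2 : ∀ s ∈ Ioc (0 : ℝ) 1, J s ≤ ENNReal.ofReal (s ^ (-(d : ℝ))) * (V * F)) :
    ∫⁻ s in Ioc (0 : ℝ) 1, J s ≤ (B + 1) * (V * F ^ (1 / (d : ℝ))) := by
  have hd' : (2 : ℝ) ≤ d := by exact_mod_cast hd
  have hzero : V = 0 ∨ F = 0 → ∫⁻ s in Ioc (0 : ℝ) 1, J s ≤ (B + 1) * (V * F ^ (1 / (d : ℝ))) := by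
    intro h
    have : ∫⁻ s in Ioc (0 : ℝ) 1, J s ≤ ∫⁻ s in Ioc (0 : ℝ) 1, 0 := by
      refine setLIntegral_mono' measurableSet_Ioc fun s hs => (h2 s hs).trans ?_
      rcases h with h | h <;> simp [h]
    exact this.trans (by simp)
  by_cases hV : V = 0
  · exact hzero (Or.inl hV)
  by_cases hF : F = 0
  · exact hzero (Or.inr hF)
  by_cases hFt : F = ⊤
  · rw [hFt, ENNReal.top_rpow_of_pos (by positivity), ENNReal.mul_top hV, ENNReal.mul_top (by simp)]
    exact le_top
  set G := F.toReal with hG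
  have hG0 : 0 < G := ENNReal.toReal_pos hF hFt
  have hFG : F = ENNReal.ofReal G := (ENNReal.ofReal_toReal hFt).symm
  set δ := G ^ (1 / (d : ℝ)) with hδ
  have hδ0 : 0 < δ := Real.rpow_pos_of_pos hG0 _
  have hFδ : F ^ (1 / (d : ℝ)) = ENNReal.ofReal δ := by
    rw [hFG, ENNReal.ofReal_rpow_of_pos hG0]
  have hGδ : G * δ ^ (-(d : ℝ) + 1) = δ := by
    have : G = δ ^ (d : ℝ) := by
      rw [hδ, ← Real.rpow_mul hG0.le, one_div_mul_cancel (by positivity), Real.rpow_one]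
    rw [this, ← Real.rpow_add hδ0]; simp
  have hsub : Ioc (0 : ℝ) 1 ⊆ (Ioc 0 1 ∩ Ioc 0 δ) ∪ (Ioc 0 1 ∩ Ioi δ) := fun s hs => by
    rcases le_or_gt s δ with h | h
    · exact Or.inl ⟨hs, hs.1, h⟩
    · exact Or.inr ⟨hs, h⟩
  have hA : ∫⁻ s in Ioc (0 : ℝ) 1 ∩ Ioc 0 δ, J s ≤ B * (V * ENNReal.ofReal δ) := by
    calc _ ≤ ∫⁻ s in Ioc (0 : ℝ) 1 ∩ Ioc 0 δ, B * V :=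
          setLIntegral_mono' (measurableSet_Ioc.inter measurableSet_Ioc) fun s hs => h1 s hs.1
      _ ≤ ∫⁻ s in Ioc 0 δ, B * V := lintegral_mono_set inter_subset_right
      _ = B * (V * ENNReal.ofReal δ) := by simp [mul_assoc]
  have hB : ∫⁻ s in Ioc (0 : ℝ) 1 ∩ Ioi δ, J s ≤ V * ENNReal.ofReal δ := by
    calc _ ≤ ∫⁻ s in Ioc (0 : ℝ) 1 ∩ Ioi δ, ENNReal.ofReal (s ^ (-(d : ℝ))) * (V * F) :=
          setLIntegral_mono' (measurableSet_Ioc.inter measurableSet_Ioi) fun s hs => h2 s hs.1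
      _ ≤ ∫⁻ s in Ioi δ, ENNReal.ofReal (s ^ (-(d : ℝ))) * (V * F) :=
          lintegral_mono_set inter_subset_right
      _ = (∫⁻ s in Ioi δ, ENNReal.ofReal (s ^ (-(d : ℝ)))) * (V * F) :=
          lintegral_mul_const _ (by fun_prop)
      _ = ENNReal.ofReal (-δ ^ (-(d : ℝ) + 1) / (-(d : ℝ) + 1)) * (V * F) := by
          rw [← integral_Ioi_rpow_of_lt (by linarith) hδ0, ofReal_integral_eq_lintegral_ofReal]
          · exact integrableOn_Ioi_rpow_of_lt (by linarith) hδ0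
          · filter_upwards [ae_restrict_mem measurableSet_Ioi] with s hs
            exact Real.rpow_nonneg (hδ0.le.trans (le_of_lt hs)) _
      _ ≤ ENNReal.ofReal (δ ^ (-(d : ℝ) + 1)) * (V * F) := by
          refine mul_le_mul_left (ENNReal.ofReal_le_ofReal ?_) _
          have h0 : 0 ≤ δ ^ (-(d : ℝ) + 1) := by positivity
          rw [neg_div, ← div_neg, div_le_iff₀ (by linarith)]
          nlinarith
      _ = V * ENNReal.ofReal δ := by
          rw [hFG, mul_left_comm, ← ENNReal.ofReal_mul (by positivity), mul_comm (δ ^ _), hGδ]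
  calc _ ≤ ∫⁻ s in (Ioc (0 : ℝ) 1 ∩ Ioc 0 δ) ∪ (Ioc 0 1 ∩ Ioi δ), J s := lintegral_mono_set hsub
    _ ≤ _ := lintegral_union_le _ _ _
    _ ≤ B * (V * ENNReal.ofReal δ) + V * ENNReal.ofReal δ := add_le_add hA hB
    _ = (B + 1) * (V * F ^ (1 / (d : ℝ))) := by rw [hFδ]; ring

/-- The measure `ds ⊗ dz ⊗ dx` on `(0, 1] × [0, 2)^d × ℝ^d`. -/
noncomputable def segmentMeasure (d : ℕ) : Measure (ℝ × E d × E d) :=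
  (volume.restrict (Ioc (0 : ℝ) 1)).prod ((volume.restrict (box d 2)).prod volume)

theorem measurable_segment :
    Measurable fun w : ℝ × E d × E d => w.2.2 + w.1 • w.2.1 := by fun_prop

theorem slice_le_left {F H : Set (E d)} (s : ℝ) :
    ((volume.restrict (box d 2)).prod volume) {w : E d × E d | w.2 ∈ H ∧ w.2 + s • w.1 ∈ F}
      ≤ 2 ^ d * volume H := by
  calc _ ≤ ((volume.restrict (box d 2)).prod volume) ((univ : Set (E d)) ×ˢ H) :=
        measure_mono fun w hw => ⟨mem_univ _, hw.1⟩
    _ = 2 ^ d * volume H := by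
        rw [Measure.prod_prod, Measure.restrict_apply_univ, volume_box]; simp

theorem slice_le_right {F H : Set (E d)} (hF : MeasurableSet F) (s : ℝ) :
    ((volume.restrict (box d 2)).prod volume) {w : E d × E d | w.2 ∈ H ∧ w.2 + s • w.1 ∈ F}
      ≤ 2 ^ d * volume F := by
  have hm : MeasurableSet {w : E d × E d | w.2 + s • w.1 ∈ F} :=
    (by fun_prop : Measurable fun w : E d × E d => w.2 + s • w.1) hF
  calc _ ≤ ((volume.restrict (box d 2)).prod volume) {w : E d × E d | w.2 + s • w.1 ∈ F} :=
        measure_mono fun w hw => hw.2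
    _ = ∫⁻ z in box d 2, volume F := by
        rw [Measure.prod_apply hm]
        refine lintegral_congr fun z => ?_
        exact measure_preimage_add_right volume (s • z) F
    _ = 2 ^ d * volume F := by rw [setLIntegral_const, volume_box, mul_comm]; simp

/-- For fixed $x\in H$ the map $z\mapsto x+sz$ scales volume by $s^d$, so its preimage of $F$ has
measure $s^{-d}|F|$. -/
theorem slice_le_mul {F H : Set (E d)} (hF : MeasurableSet F) (hH : MeasurableSet H)
    {s : ℝ} (hs : 0 < s) :
    ((volume.restrict (box d 2)).prod volume) {w : E d × E d | w.2 ∈ H ∧ w.2 + s • w.1 ∈ F}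
      ≤ ENNReal.ofReal (s ^ (-(d : ℝ))) * (volume H * volume F) := by
  have hm : MeasurableSet {w : E d × E d | w.2 ∈ H ∧ w.2 + s • w.1 ∈ F} :=
    (measurable_snd hH).inter ((by fun_prop : Measurable fun w : E d × E d => w.2 + s • w.1) hF)
  rw [Measure.prod_apply_symm hm]
  calc _ ≤ ∫⁻ x, H.indicator (fun _ => ENNReal.ofReal (s ^ (-(d : ℝ))) * volume F) x := by
        refine lintegral_mono fun x => ?_
        by_cases hx : x ∈ H
        · rw [indicator_of_mem hx]
          calc _ ≤ volume ((fun z : E d => s • z) ⁻¹' ((fun y => x + y) ⁻¹' F)) :=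
                (Measure.restrict_apply_le _ _).trans (measure_mono fun z hz => hz.2)
            _ = ENNReal.ofReal (s ^ (-(d : ℝ))) * volume F := by
                rw [Measure.addHaar_preimage_smul _ hs.ne', measure_preimage_add]
                simp [abs_of_pos (pow_pos hs d), Real.rpow_neg hs.le]
        · simp [hx]
    _ = _ := by rw [lintegral_indicator hH, setLIntegral_const]; ring

theorem measurableSet_segment {F H : Set (E d)} (hF : MeasurableSet F)
    (hH : MeasurableSet H) :
    MeasurableSet {w : ℝ × E d × E d | w.2.2 ∈ H ∧ w.2.2 + w.1 • w.2.1 ∈ F} :=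
  (measurable_snd.comp measurable_snd hH).inter (measurable_segment hF)

/-- One endpoint on indicator functions; `segmentMeasure_le_right` is the other. Neither suffices
alone: `lintegral_mul_le_of_superlevel` combines the two into a strong-type bound. -/
theorem segmentMeasure_le_left {F H : Set (E d)} (hF : MeasurableSet F)
    (hH : MeasurableSet H) (hd : 2 ≤ d) :
    segmentMeasure d {w : ℝ × E d × E d | w.2.2 ∈ H ∧ w.2.2 + w.1 • w.2.1 ∈ F} ≤
      (2 ^ d + 1) * (volume H * volume F ^ (1 / (d : ℝ))) := by
  rw [segmentMeasure, Measure.prod_apply (measurableSet_segment hF hH)]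
  exact lintegral_min_scaling_le hd (fun s _ => slice_le_left s)
    fun s hs => slice_le_mul hF hH hs.1

theorem segmentMeasure_le_right {F H : Set (E d)} (hF : MeasurableSet F)
    (hH : MeasurableSet H) (hd : 2 ≤ d) :
    segmentMeasure d {w : ℝ × E d × E d | w.2.2 ∈ H ∧ w.2.2 + w.1 • w.2.1 ∈ F} ≤
      (2 ^ d + 1) * (volume F * volume H ^ (1 / (d : ℝ))) := by
  rw [segmentMeasure, Measure.prod_apply (measurableSet_segment hF hH)]
  exact lintegral_min_scaling_le hd (fun s _ => slice_le_right hF s)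
    fun s hs => (slice_le_mul hF hH hs.1).trans_eq (by rw [mul_comm (volume H)])

/-- Layer cake for $(f/a)^\beta$, with the prefactor $\beta\ge1$ discarded. -/
theorem lintegral_superlevel_le_one {f : E d → ℝ} (hf : Measurable f) (f0 : ∀ x, 0 ≤ f x)
    {β a : ℝ} (hβ : 1 < β) (ha : 0 < a)
    (h : ∫⁻ x, ENNReal.ofReal (f x ^ β) ≤ ENNReal.ofReal (a ^ β)) :
    ∫⁻ t in Ioi (0 : ℝ), volume {x | t < f x / a} * ENNReal.ofReal (t ^ (β - 1)) ≤ 1 := by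
  have hβ0 : 0 < β := by linarith
  have e := lintegral_rpow_eq_lintegral_meas_lt_mul (volume : Measure (E d))
    (f := fun x => f x / a) (Filter.Eventually.of_forall fun x => div_nonneg (f0 x) ha.le)
    (hf.div_const a).aemeasurable hβ0
  have h2 : ∫⁻ x, ENNReal.ofReal ((f x / a) ^ β) ≤ 1 := by
    have : ∀ x, ENNReal.ofReal ((f x / a) ^ β) =
        ENNReal.ofReal (f x ^ β) * ENNReal.ofReal (a ^ β)⁻¹ := fun x => by
      rw [Real.div_rpow (f0 x) ha.le, div_eq_mul_inv,
        ENNReal.ofReal_mul (Real.rpow_nonneg (f0 x) _)]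
    simp only [this]
    rw [lintegral_mul_const _ (by fun_prop)]
    refine (mul_le_mul_left h _).trans ?_
    rw [← ENNReal.ofReal_mul (by positivity), mul_inv_cancel₀ (by positivity)]
    simp
  rw [e] at h2
  refine le_trans ?_ h2
  refine le_mul_of_one_le_left bot_le ?_
  rw [← ENNReal.ofReal_one]
  exact ENNReal.ofReal_le_ofReal hβ.le

/-- A Hardy-Littlewood-Sobolev inequality for averages over segments. -/
theorem lintegral_segment_le (hd : 2 ≤ d) {β q : ℝ} (hβ : 1 < β) (hq : 1 < q)
    (hs : 1 / β + 1 / q = 1 + 1 / (d : ℝ)) {f h : E d → ℝ} (hf : Measurable f) (hh : Measurable h)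
    (f0 : ∀ x, 0 ≤ f x) (h0 : ∀ x, 0 ≤ h x) {a b : ℝ} (ha : 0 < a) (hb : 0 < b)
    (hfa : ∫⁻ x, ENNReal.ofReal (f x ^ β) ≤ ENNReal.ofReal (a ^ β))
    (hhb : ∫⁻ x, ENNReal.ofReal (h x ^ q) ≤ ENNReal.ofReal (b ^ q)) :
    ∫⁻ w, ENNReal.ofReal (h w.2.2) * ENNReal.ofReal (f (w.2.2 + w.1 • w.2.1)) ∂(segmentMeasure d) ≤
      (2 ^ d + 1) * bilinearConst (1 / d) β q * (ENNReal.ofReal a * ENNReal.ofReal b) := by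
  have hd' : (2 : ℝ) ≤ d := by exact_mod_cast hd
  have anti : ∀ g : E d → ℝ, Measurable fun t : ℝ => volume {x | t < g x} := fun g =>
    Antitone.measurable fun s t hst => measure_mono fun x (hx : t < g x) => hst.trans_lt hx
  have hfm : Measurable fun x => f x / a := hf.div_const a
  have hhm : Measurable fun x => h x / b := hh.div_const b
  have hfs : ∀ t, MeasurableSet {x | t < f x / a} := fun t => measurableSet_lt measurable_const hfm
  have hhs : ∀ t, MeasurableSet {x | t < h x / b} := fun t => measurableSet_lt measurable_const hhm
  have key := lintegral_mul_le_of_superlevel (segmentMeasure d)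
    (f := fun w => f (w.2.2 + w.1 • w.2.1) / a) (h := fun w => h w.2.2 / b)
    (hfm.comp measurable_segment) (hhm.comp (measurable_snd.comp measurable_snd))
    (fun w => div_nonneg (f0 _) ha.le) (fun w => div_nonneg (h0 _) hb.le)
    (θ := 1 / d) (by positivity) (by rw [div_lt_one (by linarith)]; linarith) hβ hq hs
    (F := fun t => volume {x | t < f x / a}) (H := fun t => volume {x | t < h x / b})
    (anti _) (anti _) (lintegral_superlevel_le_one hf f0 hβ ha hfa)
    (lintegral_superlevel_le_one hh h0 hq hb hhb) (M := 2 ^ d + 1)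
    (ENNReal.add_ne_top.2 ⟨by simp, by simp⟩)
    (fun s t _ _ => segmentMeasure_le_right (hfs s) (hhs t) hd)
    (fun s t _ _ => segmentMeasure_le_left (hfs s) (hhs t) hd)
  have e : ∀ w : ℝ × E d × E d,
      ENNReal.ofReal (h w.2.2) * ENNReal.ofReal (f (w.2.2 + w.1 • w.2.1)) =
      (ENNReal.ofReal a * ENNReal.ofReal b) *
        (ENNReal.ofReal (h w.2.2 / b) * ENNReal.ofReal (f (w.2.2 + w.1 • w.2.1) / a)) := by
    intro w
    rw [← ENNReal.ofReal_mul (h0 _), ← ENNReal.ofReal_mul ha.le,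
      ← ENNReal.ofReal_mul (div_nonneg (h0 _) hb.le), ← ENNReal.ofReal_mul (by positivity)]
    congr 1
    field_simp
  simp only [e]
  rw [lintegral_const_mul' _ _ (by finiteness), mul_comm]
  exact mul_le_mul_left key _

/-! ### Time slices and conservation of the law of the density -/

section Slices

variable {F : Type*} [NormedAddCommGroup F] [NormedSpace ℝ F] {f : ℝ → E d → F}

theorem SmoothInTimeSpace.contDiff (hf : SmoothInTimeSpace f) {t : ℝ} (ht : 0 ≤ t) :
    ContDiff ℝ ∞ (f t) := by
  rw [← contDiffOn_univ]
  exact ContDiffOn.comp (g := fun z : ℝ × E d => f z.1 z.2) hf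
    (f := fun x : E d => (t, x)) (by fun_prop) fun x _ => ⟨ht, mem_univ _⟩

theorem SmoothInTimeSpace.continuousOn (hf : SmoothInTimeSpace f) :
    ContinuousOn (fun z : ℝ × E d => f z.1 z.2) (Ici 0 ×ˢ univ) :=
  ContDiffOn.continuousOn hf

/-- The spatial derivative is the derivative within $[0,\infty)\times\mathbb R^d$ restricted to
spatial directions. Continuity up to $t=0$ is needed for Fubini on $(0,t]\times\mathbb T^d$. -/
theorem SmoothInTimeSpace.continuousOn_fderiv (hf : SmoothInTimeSpace f) :
    ContinuousOn (fun z : ℝ × E d => fderiv ℝ (f z.1) z.2) (Ici 0 ×ˢ univ) := by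
  have hU : UniqueDiffOn ℝ (Ici (0 : ℝ) ×ˢ (univ : Set (E d))) :=
    (uniqueDiffOn_Ici 0).prod uniqueDiffOn_univ
  have hc : ContinuousOn (fderivWithin ℝ (fun z : ℝ × E d => f z.1 z.2) (Ici 0 ×ˢ univ))
      (Ici 0 ×ˢ univ) := ContDiffOn.continuousOn_fderivWithin hf hU (by simp)
  refine (hc.clm_comp (continuousOn_const (c := ContinuousLinearMap.inr ℝ ℝ (E d)))).congr ?_
  rintro ⟨t, x⟩ hz
  have h1 := ((ContDiffOn.differentiableOn hf (by simp)) (t, x) hz).hasFDerivWithinAt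
  have h2 : HasFDerivWithinAt (fun x : E d => (t, x)) (ContinuousLinearMap.inr ℝ ℝ (E d)) univ x :=
    (hasFDerivAt_prodMk_right t x).hasFDerivWithinAt
  have h3 := h1.comp x h2 (fun y _ => ⟨hz.1, mem_univ _⟩)
  rw [hasFDerivWithinAt_univ] at h3
  exact h3.fderiv

theorem SmoothInTimeSpace.differentiableAt_time (hf : SmoothInTimeSpace f) {t : ℝ} (ht : 0 < t)
    (x : E d) : DifferentiableAt ℝ (fun s => f s x) t := by
  have h : ContDiffAt ℝ ∞ (fun z : ℝ × E d => f z.1 z.2) (t, x) :=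
    ContDiffOn.contDiffAt hf (prod_mem_nhds (Ici_mem_nhds ht) Filter.univ_mem)
  exact (h.differentiableAt (by simp)).comp t (by fun_prop : DifferentiableAt ℝ (fun s => (s, x)) t)

end Slices

section Transport

variable {p : ℝ} {ν : ℝ → ℝ} {g : E d} {ρ₀ : E d → ℝ} {ρ : ℝ → E d → ℝ} {u : ℝ → E d → E d}
  {π : ℝ → E d → ℝ}

/-- Integrals of smooth functions of the density are conserved. -/
theorem IsSmoothSolution.integral_comp_density (hsol : IsSmoothSolution p ν g ρ₀ ρ u π)
    {F : ℝ → ℂ} (hF : ContDiff ℝ 1 F) {t : ℝ} (ht : 0 ≤ t) :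
    ∫ x, F (ρ t x) ∂(torus d) = ∫ x, F (ρ₀ x) ∂(torus d) := by
  set G : ℝ → E d → ℂ := fun s x => fderiv ℝ F (ρ s x) (fderiv ℝ (ρ s) x (u s x)) with hG
  have hIcc : Icc 0 t ×ˢ (univ : Set (E d)) ⊆ Ici 0 ×ˢ univ := prod_mono_left Icc_subset_Ici_self
  have hFd : Continuous (fderiv ℝ F) := hF.continuous_fderiv one_ne_zero
  have hGc : ContinuousOn (Function.uncurry G) (Icc 0 t ×ˢ univ) := by
    have h1 := hsol.smooth_density.continuousOn.mono hIcc
    have h2 := hsol.smooth_density.continuousOn_fderiv.mono hIcc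
    have h3 := hsol.smooth_velocity.continuousOn.mono hIcc
    exact (hFd.comp_continuousOn h1).clm_apply (h2.clm_apply h3)
  have hpt : ∀ x, F (ρ t x) - F (ρ₀ x) = - ∫ s in Ioc 0 t, G s x := by
    intro x
    have hslice : ContinuousOn (fun s => (s, x)) (Icc 0 t) := by fun_prop
    have hmaps : MapsTo (fun s => (s, x)) (Icc 0 t) (Icc 0 t ×ˢ (univ : Set (E d))) :=
      fun s hs => ⟨hs, mem_univ _⟩
    have hcont : ContinuousOn (fun s => F (ρ s x)) (Icc 0 t) :=
      hF.continuous.comp_continuousOn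
        ((hsol.smooth_density.continuousOn.mono hIcc).comp hslice hmaps)
    have hGx : ContinuousOn (fun s => G s x) (Icc 0 t) := hGc.comp hslice hmaps
    -- The transport equation is available only for positive times; continuity at the endpoints is
    -- enough for the fundamental theorem of calculus.
    have hder : ∀ s ∈ Ioo 0 t, HasDerivAt (fun s => F (ρ s x)) (-G s x) s := by
      intro s hs
      have h1 := (hsol.smooth_density.differentiableAt_time hs.1 x).hasDerivAt
      have h2 : deriv (fun s => ρ s x) s = - fderiv ℝ (ρ s) x (u s x) :=
        eq_neg_of_add_eq_zero_left (hsol.transport s hs.1 x)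
      rw [h2] at h1
      have h3 := ((hF.differentiable one_ne_zero) (ρ s x)).hasFDerivAt.comp_hasDerivAt s h1
      rwa [map_neg] at h3
    have h4 := intervalIntegral.integral_eq_sub_of_hasDerivAt_of_le ht hcont hder
      (hGx.neg.intervalIntegrable_of_Icc ht)
    rw [hsol.initial] at h4
    rw [← h4, intervalIntegral.integral_of_le ht, integral_neg]
  -- By the chain rule `G s` is $u\cdot\nabla(F\circ\rho)$, a divergence-free field paired with a
  -- periodic gradient.
  have hspace : ∀ s, 0 ≤ s → ∫ x, G s x ∂(torus d) = 0 := by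
    intro s hs
    have hρ : ContDiff ℝ 1 (ρ s) := (hsol.smooth_density.contDiff hs).of_le (by simp)
    have hu : ContDiff ℝ 1 (u s) := (hsol.smooth_velocity.contDiff hs).of_le (by simp)
    have h := integral_fderiv_divFree (w := fun x => F (ρ s x)) (hF.comp hρ) hu
      (fun x i => by simp only [hsol.periodic_density s hs x i]) (hsol.periodic_velocity s hs)
      (hsol.div_free s hs)
    rw [← h]
    congr 1
    ext x
    have h5 := ((hF.differentiable one_ne_zero) (ρ s x)).hasFDerivAt.comp x
      ((hρ.differentiable one_ne_zero) x).hasFDerivAt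
    have h6 : fderiv ℝ (fun x => F (ρ s x)) x = (fderiv ℝ F (ρ s x)).comp (fderiv ℝ (ρ s) x) :=
      h5.fderiv
    rw [h6]; rfl
  have hswap := integral_integral_swap (integrable_Ioc_prod_torus hGc)
  have hz : ∫ s in Ioc 0 t, ∫ x, G s x ∂(torus d) = 0 := by
    rw [setIntegral_congr_fun measurableSet_Ioc (g := fun _ => (0 : ℂ))
      fun s hs => hspace s hs.1.le]
    simp
  rw [hz] at hswap
  have hρt : Continuous (ρ t) := (hsol.smooth_density.contDiff ht).continuous
  have hρ0 : Continuous ρ₀ := hsol.initial ▸ (hsol.smooth_density.contDiff le_rfl).continuous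
  rw [← sub_eq_zero, ← integral_sub (f := fun x => F (ρ t x)) (g := fun x => F (ρ₀ x))
    (hF.continuous.comp hρt).integrable_torus (hF.continuous.comp hρ0).integrable_torus]
  simp only [hpt, integral_neg, ← hswap, neg_zero]

/-- The density is equimeasurable with the initial density. -/
theorem IsSmoothSolution.map_density (hsol : IsSmoothSolution p ν g ρ₀ ρ u π) {t : ℝ}
    (ht : 0 ≤ t) : (torus d).map (ρ t) = (torus d).map ρ₀ := by
  have hρt : Continuous (ρ t) := (hsol.smooth_density.contDiff ht).continuous
  have hρ0 : Continuous ρ₀ := hsol.initial ▸ (hsol.smooth_density.contDiff le_rfl).continuous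
  have := Measure.isFiniteMeasure_map (torus d) (ρ t)
  have := Measure.isFiniteMeasure_map (torus d) ρ₀
  refine Measure.ext_of_charFun ?_
  ext s
  -- Smooth test functions suffice to identify a finite measure through its characteristic function,
  -- so $|r|^q$ and $1/|r|$ need no regularization.
  have hF : ContDiff ℝ 1 fun r : ℝ => Complex.exp (s * r * Complex.I) := by
    have : ContDiff ℝ 1 fun r : ℝ => (r : ℂ) := Complex.ofRealCLM.contDiff
    fun_prop
  simp only [charFun_apply_real]
  rw [integral_map hρt.aemeasurable hF.continuous.aestronglyMeasurable,
    integral_map hρ0.aemeasurable hF.continuous.aestronglyMeasurable]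
  exact hsol.integral_comp_density hF ht

theorem IsSmoothSolution.eLpNorm_comp_density (hsol : IsSmoothSolution p ν g ρ₀ ρ u π) {t : ℝ}
    (ht : 0 ≤ t) {ε : Type*} [MeasurableSpace ε] [TopologicalSpace ε] [ContinuousENorm ε]
    [OpensMeasurableSpace ε] [TopologicalSpace.PseudoMetrizableSpace ε]
    [SecondCountableTopology ε]
    {F : ℝ → ε} (hF : Measurable F) (r : ℝ≥0∞) :
    eLpNorm (fun x => F (ρ t x)) r (torus d) = eLpNorm (fun x => F (ρ₀ x)) r (torus d) := by
  have hρt : Continuous (ρ t) := (hsol.smooth_density.contDiff ht).continuous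
  have hρ0 : Continuous ρ₀ := hsol.initial ▸ (hsol.smooth_density.contDiff le_rfl).continuous
  have h1 := eLpNorm_map_measure (p := r) (f := ρ t) (μ := torus d)
    hF.stronglyMeasurable.aestronglyMeasurable hρt.aemeasurable
  have h2 := eLpNorm_map_measure (p := r) (f := ρ₀) (μ := torus d)
    hF.stronglyMeasurable.aestronglyMeasurable hρ0.aemeasurable
  rw [hsol.map_density ht] at h1
  exact h1.symm.trans h2

/-- This carries the lower bound on $\nu$, known only at values of $\rho_0$, to almost every value
of $\rho(t)$. -/
theorem IsSmoothSolution.ae_density (hsol : IsSmoothSolution p ν g ρ₀ ρ u π) {t : ℝ}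
    (ht : 0 ≤ t) {P : ℝ → Prop} (hP : MeasurableSet {r | P r}) (h : ∀ᵐ x ∂(torus d), P (ρ₀ x)) :
    ∀ᵐ x ∂(torus d), P (ρ t x) := by
  have hρt : Continuous (ρ t) := (hsol.smooth_density.contDiff ht).continuous
  have hρ0 : Continuous ρ₀ := hsol.initial ▸ (hsol.smooth_density.contDiff le_rfl).continuous
  rw [← ae_map_iff hρt.aemeasurable hP, hsol.map_density ht, ae_map_iff hρ0.aemeasurable hP]
  exact h

/-- The `L^r` norms of the density are conserved. -/
theorem IsSmoothSolution.eLpNorm_density (hsol : IsSmoothSolution p ν g ρ₀ ρ u π) {t : ℝ}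
    (ht : 0 ≤ t) (r : ℝ≥0∞) : eLpNorm (ρ t) r (torus d) = eLpNorm ρ₀ r (torus d) :=
  hsol.eLpNorm_comp_density ht (F := fun r => r) measurable_id r

theorem IsSmoothSolution.invNorm_density (hsol : IsSmoothSolution p ν g ρ₀ ρ u π) {t : ℝ}
    (ht : 0 ≤ t) (r : ℝ≥0∞) : invNorm (ρ t) r = invNorm ρ₀ r :=
  hsol.eLpNorm_comp_density ht (F := fun r => (‖r‖ₑ)⁻¹) (by fun_prop) r

end Transport

/-! ### Strain and the Korn–Sobolev inequality -/

theorem contract_self_nonneg (A : Matrix (Fin d) (Fin d) ℝ) : 0 ≤ contract A A :=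
  Finset.sum_nonneg fun _ _ => Finset.sum_nonneg fun _ _ => mul_self_nonneg _

theorem matNorm_nonneg (A : Matrix (Fin d) (Fin d) ℝ) : 0 ≤ matNorm A := Real.sqrt_nonneg _

theorem matNorm_sq (A : Matrix (Fin d) (Fin d) ℝ) : matNorm A ^ 2 = contract A A :=
  Real.sq_sqrt (contract_self_nonneg A)

theorem abs_entry_le_matNorm (A : Matrix (Fin d) (Fin d) ℝ) (i j : Fin d) :
    |A i j| ≤ matNorm A := by
  refine Real.abs_le_sqrt ?_
  have h1 : A i j ^ 2 ≤ ∑ j, A i j * A i j := by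
    rw [sq]
    exact Finset.single_le_sum (f := fun j => A i j * A i j) (fun _ _ => mul_self_nonneg _)
      (Finset.mem_univ j)
  exact h1.trans (Finset.single_le_sum (f := fun i => ∑ j, A i j * A i j)
    (fun _ _ => Finset.sum_nonneg fun _ _ => mul_self_nonneg _) (Finset.mem_univ i))

/-- The antisymmetric part of the gradient vanishes in a quadratic form. This is the only point
where the full gradient is replaced by the strain, so no separate Korn inequality is required. -/
theorem inner_fderiv_eq (u : E d → E d) (y z : E d) :
    inner ℝ z (fderiv ℝ u y z) = ∑ i, ∑ j, z i * z j * strain u y i j := by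
  have h1 : inner ℝ z (fderiv ℝ u y z) = ∑ j, ∑ i, z i * z j * partialDeriv u i j y := by
    rw [PiLp.inner_apply]
    refine Finset.sum_congr rfl fun j _ => ?_
    conv_lhs => rw [← sum_coord_smul_e z, map_sum]
    rw [sum_coord_smul_e]
    simp only [map_smul, WithLp.ofLp_sum, Finset.sum_apply, WithLp.ofLp_smul,
      Pi.smul_apply, RCLike.inner_apply, conj_trivial, smul_eq_mul, Finset.sum_mul]
    refine Finset.sum_congr rfl fun i _ => ?_
    rw [partialDeriv]; ring
  have h2 : ∑ i, ∑ j, z i * z j * partialDeriv u i j y =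
      ∑ i, ∑ j, z i * z j * partialDeriv u j i y := by
    rw [Finset.sum_comm]
    exact Finset.sum_congr rfl fun i _ => Finset.sum_congr rfl fun j _ => by ring
  have h3 : ∑ i, ∑ j, z i * z j * strain u y i j =
      (∑ i, ∑ j, z i * z j * partialDeriv u i j y +
        ∑ i, ∑ j, z i * z j * partialDeriv u j i y) / 2 := by
    simp only [← Finset.sum_add_distrib, Finset.sum_div]
    refine Finset.sum_congr rfl fun i _ => Finset.sum_congr rfl fun j _ => ?_
    simp only [strain, Matrix.of_apply]; ring
  rw [h3, ← h2, h1, Finset.sum_comm]; ring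

theorem abs_inner_fderiv_le (u : E d → E d) (y : E d) {z : E d} (hz : z ∈ box d 2) :
    |inner ℝ z (fderiv ℝ u y z)| ≤ 4 * d ^ 2 * matNorm (strain u y) := by
  rw [inner_fderiv_eq]
  have hzi : ∀ i, |z i| ≤ 2 := fun i => by
    rw [abs_of_nonneg (hz i).1]; exact (hz i).2.le
  calc |∑ i, ∑ j, z i * z j * strain u y i j|
      ≤ ∑ i, ∑ j, |z i * z j * strain u y i j| :=
        (Finset.abs_sum_le_sum_abs _ _).trans
          (Finset.sum_le_sum fun i _ => Finset.abs_sum_le_sum_abs _ _)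
    _ ≤ ∑ _i : Fin d, ∑ _j : Fin d, 2 * 2 * matNorm (strain u y) := by
        refine Finset.sum_le_sum fun i _ => Finset.sum_le_sum fun j _ => ?_
        rw [abs_mul, abs_mul]
        exact mul_le_mul (mul_le_mul (hzi i) (hzi j) (abs_nonneg _) (by norm_num))
          (abs_entry_le_matNorm _ i j) (abs_nonneg _) (by norm_num)
    _ = 4 * d ^ 2 * matNorm (strain u y) := by
        simp only [Finset.sum_const, Finset.card_univ, Fintype.card_fin, nsmul_eq_mul]; ring

theorem continuous_partialDeriv {u : E d → E d} (hu : ContDiff ℝ 1 u) (i j : Fin d) :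
    Continuous (partialDeriv u i j) := by
  have h := hu.continuous_fderiv one_ne_zero
  exact (EuclideanSpace.proj (𝕜 := ℝ) j).continuous.comp (h.clm_apply continuous_const)

theorem continuous_strain {u : E d → E d} (hu : ContDiff ℝ 1 u) : Continuous (strain u) := by
  refine continuous_matrix fun i j => ?_
  have h1 := continuous_partialDeriv hu i j
  have h2 := continuous_partialDeriv hu j i
  exact (h1.add h2).div_const 2

theorem continuous_contract : Continuous fun P : Matrix (Fin d) (Fin d) ℝ ×
    Matrix (Fin d) (Fin d) ℝ => contract P.1 P.2 := by
  refine continuous_finsetSum _ fun i _ => continuous_finsetSum _ fun j _ => ?_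
  exact (continuous_fst.matrix_elem i j).mul (continuous_snd.matrix_elem i j)

theorem continuous_matNorm_strain {u : E d → E d} (hu : ContDiff ℝ 1 u) :
    Continuous fun x => matNorm (strain u x) :=
  Real.continuous_sqrt.comp
    (continuous_contract.comp ((continuous_strain hu).prodMk (continuous_strain hu)))

theorem Periodic.strain {u : E d → E d} (pu : Periodic u) : Periodic (strain u) := by
  intro x k
  have : (fun y => u (y + e k)) = u := funext fun y => pu y k
  have h2 : fderiv ℝ u (x + e k) = fderiv ℝ u x := by
    rw [← fderiv_comp_add_right (e k), this]
  ext i j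
  simp only [StokesTransport.strain, partialDeriv, h2]

theorem abs_inner_sub_le {u : E d → E d} (hu : ContDiff ℝ 1 u) (x : E d) {z : E d}
    (hz : z ∈ box d 2) :
    ENNReal.ofReal |inner ℝ z (u (x + z)) - inner ℝ z (u x)| ≤
      ENNReal.ofReal (4 * d ^ 2) *
        ∫⁻ s in Ioc (0 : ℝ) 1, ENNReal.ofReal (matNorm (strain u (x + s • z))) := by
  have hF : ContDiff ℝ 1 fun y => inner ℝ z (u y) := contDiff_const.inner ℝ hu
  have hfd : ∀ y, fderiv ℝ (fun y => inner ℝ z (u y)) y z = inner ℝ z (fderiv ℝ u y z) := by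
    intro y
    rw [fderiv_inner_apply ℝ (differentiableAt_const z) ((hu.differentiable one_ne_zero) y)]
    simp
  have hc : Continuous fun s : ℝ => matNorm (strain u (x + s • z)) :=
    (continuous_matNorm_strain hu).comp (by fun_prop)
  rw [← integral_fderiv_segment hF]
  simp only [hfd]
  rw [← ofReal_integral_eq_lintegral_ofReal hc.integrableOn_Ioc
    (Filter.Eventually.of_forall fun s => matNorm_nonneg _), ← ENNReal.ofReal_mul (by positivity),
    intervalIntegral.integral_of_le zero_le_one]
  refine ENNReal.ofReal_le_ofReal ?_
  rw [← integral_const_mul]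
  refine (abs_integral_le_integral_abs).trans ?_
  refine integral_mono_of_nonneg (Filter.Eventually.of_forall fun s => abs_nonneg _)
    (hc.integrableOn_Ioc.const_mul _) (Filter.Eventually.of_forall fun s => ?_)
  exact abs_inner_fderiv_le u _ hz

theorem cell_subset_box_two : cell d ⊆ box d 2 := fun _ hz i =>
  ⟨(hz i).1, (hz i).2.trans (by norm_num)⟩

theorem add_e_mem_box_two {z : E d} (hz : z ∈ cell d) (j : Fin d) : z + e j ∈ box d 2 := by
  intro i
  have h := hz i
  by_cases hij : i = j
  · subst hij
    simp only [e, PiLp.add_apply, PiLp.single_apply, if_true]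
    exact ⟨by linarith [h.1], by linarith [h.2]⟩
  · simp only [e, PiLp.add_apply, PiLp.single_apply, hij, if_false, add_zero]
    exact ⟨h.1, h.2.trans (by norm_num)⟩

/-- A mean-zero periodic field is controlled by averages of its strain over segments. -/
theorem ofReal_abs_coord_le {u : E d → E d} (hu : ContDiff ℝ 1 u) (pu : Periodic u)
    (h0 : ∫ x, u x ∂(torus d) = 0) (x : E d) (j : Fin d) :
    ENNReal.ofReal |u x j| ≤ ENNReal.ofReal (8 * d ^ 2) *
      ∫⁻ z in box d 2, ∫⁻ s in Ioc (0 : ℝ) 1,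
        ENNReal.ofReal (matNorm (strain u (x + s • z))) := by
  set D : E d → ℝ := fun z => inner ℝ z (u (x + z)) - inner ℝ z (u x) with hD
  set κ : E d → ℝ≥0∞ := fun z => ENNReal.ofReal (4 * d ^ 2) *
    ∫⁻ s in Ioc (0 : ℝ) 1, ENNReal.ofReal (matNorm (strain u (x + s • z))) with hκ
  have huc := hu.continuous
  have hDc : Continuous D := by fun_prop
  have hDe : Continuous fun z => D (z + e j) := by fun_prop
  have hie : ∀ w : E d, inner ℝ (e j) w = w j := fun w => by simp [e, EuclideanSpace.inner_single_left]
  -- Periodicity leaves `u (x + z)` unchanged when `z` moves by `e j`, so only the vector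
  -- multiplying the difference changes: one component of `u` is isolated.
  have hdiff : ∀ z, D (z + e j) - D z = u (x + z) j - u x j := by
    intro z
    simp only [hD, ← add_assoc, pu (x + z) j, inner_add_left, hie]
    ring
  have hmean : ∫ z, u (x + z) j ∂(torus d) = 0 := by
    have h1 : ∫ z, u (x + z) ∂(torus d) = 0 := by
      simp only [add_comm x]
      rw [pu.integral_add_right, h0]
    have h2 := (EuclideanSpace.proj (𝕜 := ℝ) j).integral_comp_comm
      (Continuous.integrable_torus (f := fun z => u (x + z)) (by fun_prop))
    rw [h1, map_zero] at h2
    exact h2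
  have hrep : u x j = ∫ z, (D z - D (z + e j)) ∂(torus d) := by
    have : ∀ z, D z - D (z + e j) = u x j - u (x + z) j := fun z => by linarith [hdiff z]
    simp only [this]
    rw [integral_sub (integrable_const _) (Continuous.integrable_torus (by fun_prop)), hmean]
    simp
  have hκm : Measurable κ := by
    have : Measurable fun w : E d × ℝ => ENNReal.ofReal (matNorm (strain u (x + w.2 • w.1))) :=
      ((continuous_matNorm_strain hu).comp (by fun_prop)).measurable.ennreal_ofReal
    exact (this.lintegral_prod_right' (ν := volume.restrict (Ioc (0 : ℝ) 1))).const_mul _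
  have hA : ∫⁻ z in cell d, ENNReal.ofReal |D z| ≤ ∫⁻ z in box d 2, κ z :=
    (setLIntegral_mono' (measurableSet_cell d) fun z hz =>
      abs_inner_sub_le hu x (cell_subset_box_two hz)).trans (lintegral_mono_set cell_subset_box_two)
  -- The shifted cell still lies in $[0,2)^d$, which is why the averages use a box of side $2$.
  have hB : ∫⁻ z in cell d, ENNReal.ofReal |D (z + e j)| ≤ ∫⁻ z in box d 2, κ z := by
    calc _ ≤ ∫⁻ z in cell d, κ (z + e j) :=
          setLIntegral_mono' (measurableSet_cell d) fun z hz =>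
            abs_inner_sub_le hu x (add_e_mem_box_two hz j)
      _ = ∫⁻ z in (fun z => z + e j) '' cell d, κ z :=
          (measurePreserving_add_right volume (e j)).setLIntegral_comp_emb
            (measurableEmbedding_addRight (e j)) _ _
      _ ≤ ∫⁻ z in box d 2, κ z := by
          refine lintegral_mono_set ?_
          rintro _ ⟨z, hz, rfl⟩
          exact add_e_mem_box_two hz j
  calc ENNReal.ofReal |u x j| = ENNReal.ofReal |∫ z, (D z - D (z + e j)) ∂(torus d)| := by
        rw [← hrep]
    _ ≤ ∫⁻ z, ENNReal.ofReal |D z - D (z + e j)| ∂(torus d) := by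
        have := enorm_integral_le_lintegral_enorm (μ := torus d) fun z => D z - D (z + e j)
        simpa only [Real.enorm_eq_ofReal_abs] using this
    _ ≤ ∫⁻ z, (ENNReal.ofReal |D z| + ENNReal.ofReal |D (z + e j)|) ∂(torus d) := by
        refine lintegral_mono fun z => ?_
        rw [← ENNReal.ofReal_add (abs_nonneg _) (abs_nonneg _)]
        exact ENNReal.ofReal_le_ofReal (abs_sub _ _)
    _ ≤ (∫⁻ z in box d 2, κ z) + ∫⁻ z in box d 2, κ z := by
        rw [lintegral_add_left (by fun_prop)]
        exact add_le_add hA hB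
    _ = _ := by
        simp only [hκ]
        rw [lintegral_const_mul' _ _ (by finiteness), ← two_mul, ← mul_assoc]
        congr 1
        rw [← ENNReal.ofReal_ofNat, ← ENNReal.ofReal_mul (by norm_num)]
        congr 1; ring

theorem ofReal_norm_le {u : E d → E d} (hu : ContDiff ℝ 1 u) (pu : Periodic u)
    (h0 : ∫ x, u x ∂(torus d) = 0) (x : E d) :
    ENNReal.ofReal ‖u x‖ ≤ ENNReal.ofReal (8 * d ^ 3) *
      ∫⁻ z in box d 2, ∫⁻ s in Ioc (0 : ℝ) 1,
        ENNReal.ofReal (matNorm (strain u (x + s • z))) := by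
  have h1 : ‖u x‖ ≤ ∑ j, |u x j| := by
    calc ‖u x‖ = ‖∑ i, u x i • (e i : E d)‖ := by rw [sum_coord_smul_e]
      _ ≤ ∑ i, ‖u x i • (e i : E d)‖ := norm_sum_le _ _
      _ = ∑ j, |u x j| := by simp [norm_smul, e]
  calc ENNReal.ofReal ‖u x‖ ≤ ENNReal.ofReal (∑ j, |u x j|) := ENNReal.ofReal_le_ofReal h1
    _ = ∑ j, ENNReal.ofReal |u x j| := ENNReal.ofReal_sum_of_nonneg fun _ _ => abs_nonneg _
    _ ≤ ∑ _j : Fin d, ENNReal.ofReal (8 * d ^ 2) *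
      ∫⁻ z in box d 2, ∫⁻ s in Ioc (0 : ℝ) 1,
        ENNReal.ofReal (matNorm (strain u (x + s • z))) :=
        Finset.sum_le_sum fun j _ => ofReal_abs_coord_le hu pu h0 x j
    _ = _ := by
        rw [Finset.sum_const, Finset.card_univ, Fintype.card_fin, nsmul_eq_mul, ← mul_assoc,
          ← ENNReal.ofReal_natCast, ← ENNReal.ofReal_mul (by positivity)]
        congr 2; ring

theorem _root_.Continuous.memLp_torus {V : Type*} [NormedAddCommGroup V] {f : E d → V}
    (hf : Continuous f) (r : ℝ≥0∞) : MemLp f r (torus d) := by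
  obtain ⟨C, hC⟩ := (isCompact_closedBall (0 : E d) (d * 1)).exists_bound_of_continuousOn
    hf.continuousOn
  refine MemLp.of_bound hf.integrable_torus.aestronglyMeasurable C ?_
  filter_upwards [ae_restrict_mem (measurableSet_cell d)] with x hx
  exact hC x (box_subset_closedBall d 1 hx)

theorem lintegral_norm_rpow_eq {V : Type*} [NormedAddCommGroup V] {f : E d → V}
    (hf : Continuous f) {r : ℝ} (hr : 0 < r) :
    ∫⁻ x, ENNReal.ofReal (‖f x‖ ^ r) ∂(torus d) =
      ENNReal.ofReal ((eLpNorm f (ENNReal.ofReal r) (torus d)).toReal ^ r) := by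
  have hfin : eLpNorm f (ENNReal.ofReal r) (torus d) ≠ ⊤ := (hf.memLp_torus _).eLpNorm_ne_top
  rw [← ENNReal.ofReal_rpow_of_nonneg ENNReal.toReal_nonneg hr.le, ENNReal.ofReal_toReal hfin,
    eLpNorm_eq_lintegral_rpow_enorm_toReal (by simpa using hr) ENNReal.ofReal_ne_top,
    ENNReal.toReal_ofReal hr.le, ← ENNReal.rpow_mul, one_div_mul_cancel hr.ne', ENNReal.rpow_one]
  refine lintegral_congr fun x => ?_
  rw [← ofReal_norm, ENNReal.ofReal_rpow_of_nonneg (norm_nonneg _) hr.le]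

/-- The constant of the Korn-Sobolev inequality. -/
noncomputable def kornConst (d : ℕ) (β q : ℝ) : ℝ :=
  8 * d ^ 3 * (2 ^ d + 1) * (bilinearConst (1 / d) β q).toReal * 3 ^ d

theorem kornConst_nonneg (d : ℕ) (β q : ℝ) : 0 ≤ kornConst d β q := by
  unfold kornConst; positivity

/-- Duality: pairing $|u|$ with $|u|^{q'-1}$ and using the segment inequality gives $X^{q'}\le
CX^{q'-1}Y$. The strict bound by `Y` keeps the normalizing constant positive even when the strain
vanishes. -/
theorem korn_sobolev_aux (hd : 2 ≤ d) {β q q' : ℝ} (hβ : 1 < β) (hq : 1 < q)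
    (hq' : 1 / q + 1 / q' = 1)
    (hs : 1 / β + 1 / q = 1 + 1 / (d : ℝ)) {u : E d → E d} (hu : ContDiff ℝ 1 u)
    (pu : Periodic u) (h0 : ∫ x, u x ∂(torus d) = 0) {Y : ℝ}
    (hY : (eLpNorm (fun x => matNorm (strain u x)) (ENNReal.ofReal β) (torus d)).toReal < Y) :
    (eLpNorm u (ENNReal.ofReal q') (torus d)).toReal ≤ kornConst d β q * Y := by
  have hβ0 : 0 < β := by linarith
  have hq0 : 0 < q := by linarith
  have hq'0 : 0 < q' := by
    have h1 : 1 / q < 1 := by rw [div_lt_one hq0]; exact hq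
    exact one_div_pos.1 (by linarith)
  have hqq : (q' - 1) * q = q' := by field_simp at hq'; linarith
  have hY0 : 0 < Y := ENNReal.toReal_nonneg.trans_lt hY
  have huc := hu.continuous
  have hAc := continuous_matNorm_strain hu
  set X := (eLpNorm u (ENNReal.ofReal q') (torus d)).toReal with hX
  have hXn : 0 ≤ X := ENNReal.toReal_nonneg
  clear_value X
  rcases hXn.eq_or_lt with hX0 | hX0
  · rw [← hX0]; exact mul_nonneg (kornConst_nonneg _ _ _) hY0.le
  -- The segment inequality lives on $\mathbb R^d$, so both functions are truncated. Side $3$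
  -- suffices: $x\in[0,1)^d$, $z\in[0,2)^d$ and $s\le1$ give $x+sz\in[0,3)^d$.
  set f : E d → ℝ := (box d (3 : ℕ)).indicator fun x => matNorm (strain u x) with hf
  set h : E d → ℝ := (cell d).indicator fun x => ‖u x‖ ^ (q' - 1) with hh
  have hfm : Measurable f := hAc.measurable.indicator (measurableSet_box _ _)
  have hhm : Measurable h := Measurable.indicator (by fun_prop) (measurableSet_cell _)
  have f0 : ∀ x, 0 ≤ f x := fun x => indicator_nonneg (fun _ _ => matNorm_nonneg _) x
  have hh0 : ∀ x, 0 ≤ h x := fun x => indicator_nonneg (fun _ _ => by positivity) x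
  have hfa : ∫⁻ x, ENNReal.ofReal (f x ^ β) ≤ ENNReal.ofReal ((3 ^ d * Y) ^ β) := by
    have e1 : ∀ x, ENNReal.ofReal (f x ^ β) = (box d (3 : ℕ)).indicator
        (fun x => ENNReal.ofReal (matNorm (strain u x) ^ β)) x := fun x => by
      by_cases hx : x ∈ box d (3 : ℕ)
      · simp only [hf, indicator_of_mem hx]
      · simp [hf, indicator_of_notMem hx, Real.zero_rpow hβ0.ne', -Nat.cast_ofNat]
    simp only [e1]
    rw [lintegral_indicator (measurableSet_box _ _)]
    have hper : Periodic fun x => ENNReal.ofReal (matNorm (strain u x) ^ β) := fun x i => by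
      simp only [pu.strain x i]
    have h2 := lintegral_norm_rpow_eq hAc hβ0
    simp only [Real.norm_of_nonneg (matNorm_nonneg _)] at h2
    refine (hper.lintegral_box_le 3).trans ?_
    rw [h2]
    have h3 : ((3 : ℕ) : ℝ≥0∞) ^ d = ENNReal.ofReal (3 ^ d) := by
      rw [ENNReal.ofReal_pow (by norm_num)]; simp
    rw [h3, ← ENNReal.ofReal_mul (by positivity), Real.mul_rpow (by positivity) hY0.le]
    refine ENNReal.ofReal_le_ofReal (mul_le_mul ?_ ?_ (by positivity) (by positivity))
    · exact Real.self_le_rpow_of_one_le (one_le_pow₀ (by norm_num)) hβ.le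
    · exact Real.rpow_le_rpow ENNReal.toReal_nonneg hY.le hβ0.le
  have hhb : ∫⁻ x, ENNReal.ofReal (h x ^ q) ≤ ENNReal.ofReal ((X ^ (q' - 1)) ^ q) := by
    have e1 : ∀ x, ENNReal.ofReal (h x ^ q) = (cell d).indicator
        (fun x => ENNReal.ofReal (‖u x‖ ^ q')) x := fun x => by
      by_cases hx : x ∈ cell d
      · simp [hh, hx, ← Real.rpow_mul (norm_nonneg _), hqq]
      · simp [hh, hx, Real.zero_rpow hq0.ne']
    simp only [e1]
    rw [lintegral_indicator (measurableSet_cell _), ← torus_eq, lintegral_norm_rpow_eq huc hq'0, ← hX,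
      ← Real.rpow_mul hX0.le, hqq]
  have key := lintegral_segment_le hd hβ hq hs hfm hhm f0 hh0
    (by positivity : 0 < 3 ^ d * Y) (Real.rpow_pos_of_pos hX0 (q' - 1)) hfa hhb
  have hmeas : Measurable fun w : ℝ × E d × E d =>
      ENNReal.ofReal (h w.2.2) * ENNReal.ofReal (f (w.2.2 + w.1 • w.2.1)) :=
    (hhm.comp (measurable_snd.comp measurable_snd)).ennreal_ofReal.mul
      (hfm.comp measurable_segment).ennreal_ofReal
  rw [segmentMeasure, lintegral_prod_symm _ hmeas.aemeasurable,
    lintegral_prod_symm _ hmeas.lintegral_prod_left'.aemeasurable] at key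
  have hlow : ENNReal.ofReal (X ^ q') ≤ ENNReal.ofReal (8 * d ^ 3) *
      ∫⁻ x, ∫⁻ z in box d 2, ∫⁻ s in Ioc (0 : ℝ) 1,
        ENNReal.ofReal (h x) * ENNReal.ofReal (f (x + s • z)) := by
    rw [hX, ← lintegral_norm_rpow_eq huc hq'0, ← lintegral_const_mul' _ _ (by finiteness), torus_eq,
      ← lintegral_indicator (measurableSet_cell _)]
    refine lintegral_mono fun x => ?_
    by_cases hx : x ∈ cell d
    · rw [indicator_of_mem hx]
      have hhx : h x = ‖u x‖ ^ (q' - 1) := indicator_of_mem hx _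
      have hfx : ∫⁻ z in box d 2, ∫⁻ s in Ioc (0 : ℝ) 1,
          ENNReal.ofReal (h x) * ENNReal.ofReal (f (x + s • z)) =
          ENNReal.ofReal (h x) * ∫⁻ z in box d 2, ∫⁻ s in Ioc (0 : ℝ) 1,
          ENNReal.ofReal (matNorm (strain u (x + s • z))) := by
        rw [← lintegral_const_mul' _ _ (by finiteness)]
        refine setLIntegral_congr_fun (measurableSet_box _ _) fun z hz => ?_
        rw [← lintegral_const_mul' _ _ (by finiteness)]
        refine setLIntegral_congr_fun measurableSet_Ioc fun s hs => ?_
        have : x + s • z ∈ box d (3 : ℕ) := by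
          intro i
          have h1 := hx i; have h2 := hz i
          simp only [PiLp.add_apply, PiLp.smul_apply, smul_eq_mul]
          refine ⟨add_nonneg h1.1 (mul_nonneg hs.1.le h2.1), ?_⟩
          have h3 : s * z i ≤ z i := mul_le_of_le_one_left h2.1 hs.2
          push_cast
          linarith [h1.2, h2.2]
        simp only [hf, indicator_of_mem this]
      rw [hfx, hhx]
      have hsplit : ‖u x‖ ^ q' = ‖u x‖ ^ (q' - 1) * ‖u x‖ := by
        rcases (norm_nonneg (u x)).eq_or_lt with h1 | h1
        · rw [← h1, Real.zero_rpow hq'0.ne', mul_zero]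
        · rw [Real.rpow_sub_one h1.ne', div_mul_cancel₀ _ h1.ne']
      rw [hsplit, ENNReal.ofReal_mul (by positivity), mul_left_comm]
      exact mul_le_mul_right (ofReal_norm_le hu pu h0 x) _
    · rw [indicator_of_notMem hx]; exact bot_le
  have hbil : bilinearConst (1 / d) β q = ENNReal.ofReal (bilinearConst (1 / d) β q).toReal :=
    (ENNReal.ofReal_toReal (by unfold bilinearConst; finiteness)).symm
  have hfin := hlow.trans (mul_le_mul_right key _)
  have hpow : (2 : ℝ≥0∞) ^ d + 1 = ENNReal.ofReal (2 ^ d + 1) := by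
    rw [ENNReal.ofReal_add (by positivity) zero_le_one, ENNReal.ofReal_pow (by norm_num)]; simp
  have hbn : 0 ≤ (bilinearConst (1 / d) β q).toReal := ENNReal.toReal_nonneg
  rw [hbil, hpow, ← ENNReal.ofReal_mul (by positivity), ← ENNReal.ofReal_mul (by positivity),
    ← ENNReal.ofReal_mul (by positivity), ← ENNReal.ofReal_mul (by positivity),
    ENNReal.ofReal_le_ofReal_iff (by positivity)] at hfin
  have hXs : X ^ q' = X ^ (q' - 1) * X := by
    rw [Real.rpow_sub_one hX0.ne', div_mul_cancel₀ _ hX0.ne']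
  have hXp : 0 < X ^ (q' - 1) := Real.rpow_pos_of_pos hX0 _
  refine le_of_mul_le_mul_left ?_ hXp
  rw [← hXs]
  refine hfin.trans_eq ?_
  unfold kornConst; ring

/-- The Korn-Sobolev inequality for mean-zero periodic fields. -/
theorem korn_sobolev (hd : 2 ≤ d) {β q q' : ℝ} (hβ : 1 < β) (hq : 1 < q)
    (hq' : 1 / q + 1 / q' = 1)
    (hs : 1 / β + 1 / q = 1 + 1 / (d : ℝ)) {u : E d → E d} (hu : ContDiff ℝ 1 u)
    (pu : Periodic u) (h0 : ∫ x, u x ∂(torus d) = 0) :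
    eLpNorm u (ENNReal.ofReal q') (torus d) ≤ ENNReal.ofReal (kornConst d β q) *
      eLpNorm (fun x => matNorm (strain u x)) (ENNReal.ofReal β) (torus d) := by
  have hX := ((hu.continuous).memLp_torus (ENNReal.ofReal q')).eLpNorm_ne_top
  have hY := ((continuous_matNorm_strain hu).memLp_torus (ENNReal.ofReal β)).eLpNorm_ne_top
  rw [← ENNReal.ofReal_toReal hX, ← ENNReal.ofReal_toReal hY,
    ← ENNReal.ofReal_mul (kornConst_nonneg _ _ _)]
  refine ENNReal.ofReal_le_ofReal ?_
  -- The auxiliary bound holds for every `Y` above the norm of the strain; let `Y` decrease to it.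
  have ht : Filter.Tendsto (fun Y => kornConst d β q * Y)
      (nhdsWithin (eLpNorm (fun x => matNorm (strain u x)) (ENNReal.ofReal β) (torus d)).toReal
        (Ioi (eLpNorm (fun x => matNorm (strain u x)) (ENNReal.ofReal β) (torus d)).toReal))
      (nhds (kornConst d β q *
        (eLpNorm (fun x => matNorm (strain u x)) (ENNReal.ofReal β) (torus d)).toReal)) :=
    (continuous_const.mul continuous_id).continuousWithinAt
  refine ge_of_tendsto ht ?_
  filter_upwards [self_mem_nhdsWithin] with Y hYY
  exact korn_sobolev_aux hd hβ hq hq' hs hu pu h0 hYY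

/-! ### Energy estimate and absorption -/

/-- A mean-zero divergence-free periodic field is orthogonal to periodic gradients. -/
theorem integral_periodic_gradient {w : E d → ℝ} {u : E d → E d} (hw : ContDiff ℝ 1 w)
    (hu : ContDiff ℝ 1 u) (pw : Periodic (fderiv ℝ w)) (pu : Periodic u)
    (hdiv : ∀ x, divergence u x = 0) (h0 : ∫ x, u x ∂(torus d) = 0) :
    ∫ x, fderiv ℝ w x (u x) ∂(torus d) = 0 := by
  have hwd := hw.differentiable one_ne_zero
  -- Each increment over a period has zero gradient, hence is constant. Subtracting the linear form
  -- `L` with these increments makes `w` periodic, and `L` itself pairs to zero with a mean-zero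
  -- field.
  have hc : ∀ i x, w (x + e i) - w x = w (0 + e i) - w 0 := by
    intro i x
    refine is_const_of_fderiv_eq_zero (𝕜 := ℝ) (f := fun x => w (x + e i) - w x)
      (by fun_prop) (fun y => ?_) x 0
    rw [fderiv_fun_sub (by fun_prop) (hwd y), fderiv_comp_add_right, pw y i, sub_self]
  set L : E d →L[ℝ] ℝ := ∑ i, (w (0 + e i) - w 0) • EuclideanSpace.proj i with hL
  have hLe : ∀ i, L (e i) = w (0 + e i) - w 0 := by
    intro i
    simp [hL, e]
  have hper : Periodic fun x => w x - L x := by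
    intro x i
    have := hc i x
    simp only [map_add, hLe]
    linarith
  have h1 := integral_fderiv_divFree (w := fun x => w x - L x) (hw.sub L.contDiff) hu hper pu hdiv
  have h2 : ∀ x, fderiv ℝ (fun x => w x - L x) x (u x) = fderiv ℝ w x (u x) - L (u x) := by
    intro x
    rw [fderiv_fun_sub (hwd x) L.differentiableAt]
    simp
  have huc := hu.continuous
  have hwc := hw.continuous_fderiv one_ne_zero
  simp only [h2] at h1
  rw [integral_sub (Continuous.integrable_torus (by fun_prop))
    (Continuous.integrable_torus (by fun_prop)), L.integral_comp_comm huc.integrable_torus, h0,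
    map_zero, sub_zero] at h1
  exact h1

theorem contract_stress_strain {p : ℝ} (hp : 1 < p) (ν : ℝ → ℝ) (ρ : E d → ℝ) (u : E d → E d)
    (x : E d) : contract (stress p ν ρ u x) (strain u x) =
      ν (ρ x) * matNorm (strain u x) ^ p := by
  have h1 : contract (stress p ν ρ u x) (strain u x) =
      (ν (ρ x) * matNorm (strain u x) ^ (p - 2)) * matNorm (strain u x) ^ 2 := by
    rw [matNorm_sq]
    simp only [contract, stress, Matrix.smul_apply, smul_eq_mul, Finset.mul_sum, mul_assoc]
  rw [h1, mul_assoc]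
  congr 1
  -- Where the strain vanishes, the factor `matNorm ^ 2` kills the left side whatever value is
  -- assigned to $0^{p-2}$.
  rcases (matNorm_nonneg (strain u x)).eq_or_lt with h | h
  · simp [← h, Real.zero_rpow (zero_lt_one.trans hp).ne']
  · rw [← Real.rpow_natCast, ← Real.rpow_add h]; simp

/-- The energy inequality for the Stokes equation. -/
theorem StokesEq.energy_le {p q q' : ℝ} (hp : 1 < p) (hqq' : q.HolderConjugate q') {ν : ℝ → ℝ}
    (hν : Continuous ν) (hν0 : ∀ r, 0 ≤ ν r) {g : E d} {ρ : E d → ℝ} {u : E d → E d} {π : E d → ℝ}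
    (hS : StokesEq p ν g ρ u π) (hρ : Continuous ρ) (hu : ContDiff ℝ ∞ u) (hπ : ContDiff ℝ ∞ π)
    (pu : Periodic u) (pπ : Periodic (fderiv ℝ π)) (hdiv : ∀ x, divergence u x = 0)
    (h0 : ∫ x, u x ∂(torus d) = 0) :
    ∫⁻ x, ENNReal.ofReal (ν (ρ x) * matNorm (strain u x) ^ p) ∂(torus d) ≤
      ENNReal.ofReal ‖g‖ * (eLpNorm ρ (ENNReal.ofReal q) (torus d) *
        eLpNorm u (ENNReal.ofReal q') (torus d)) := by
  have hu1 : ContDiff ℝ 1 u := hu.of_le (by simp)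
  have huc := hu.continuous
  have hAc := continuous_matNorm_strain hu1
  have hE := hS u hu pu
  rw [integral_periodic_gradient (hπ.of_le (by simp)) hu1 pπ pu hdiv h0, add_zero] at hE
  simp only [contract_stress_strain hp] at hE
  have hcont : Continuous fun x => ν (ρ x) * matNorm (strain u x) ^ p :=
    (hν.comp hρ).mul (hAc.rpow_const fun x => Or.inr (by linarith))
  rw [← ofReal_integral_eq_lintegral_ofReal hcont.integrable_torus (Filter.Eventually.of_forall
    fun x => mul_nonneg (hν0 _) (Real.rpow_nonneg (matNorm_nonneg _) _)), hE]
  have hq := hqq'.pos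
  have hq' := hqq'.symm.pos
  calc ENNReal.ofReal (∫ x, ρ x * inner ℝ g (u x) ∂(torus d))
      ≤ ∫⁻ x, ‖ρ x * inner ℝ g (u x)‖ₑ ∂(torus d) := by
        refine le_trans ?_ (enorm_integral_le_lintegral_enorm _)
        rw [Real.enorm_eq_ofReal_abs]
        exact ENNReal.ofReal_le_ofReal (le_abs_self _)
    _ ≤ ∫⁻ x, ENNReal.ofReal ‖g‖ * (‖ρ x‖ₑ * ‖u x‖ₑ) ∂(torus d) := by
        refine lintegral_mono fun x => ?_
        rw [← ofReal_norm (ρ x), ← ofReal_norm (u x), ← ofReal_norm,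
          ← ENNReal.ofReal_mul (norm_nonneg _), ← ENNReal.ofReal_mul (norm_nonneg _), norm_mul]
        refine ENNReal.ofReal_le_ofReal ?_
        have := norm_inner_le_norm (𝕜 := ℝ) g (u x)
        calc ‖ρ x‖ * ‖inner ℝ g (u x)‖ ≤ ‖ρ x‖ * (‖g‖ * ‖u x‖) := by gcongr
          _ = _ := by ring
    _ = ENNReal.ofReal ‖g‖ * ∫⁻ x, ‖ρ x‖ₑ * ‖u x‖ₑ ∂(torus d) :=
        lintegral_const_mul' _ _ (by finiteness)
    _ ≤ _ := by
        refine mul_le_mul_right ?_ _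
        rw [eLpNorm_eq_lintegral_rpow_enorm_toReal (by simpa using hq) ENNReal.ofReal_ne_top,
          eLpNorm_eq_lintegral_rpow_enorm_toReal (by simpa using hq') ENNReal.ofReal_ne_top,
          ENNReal.toReal_ofReal hq.le, ENNReal.toReal_ofReal hq'.le]
        exact ENNReal.lintegral_mul_le_Lp_mul_Lq _ hqq' (by fun_prop) (by fun_prop)

/-- On a probability space a finite $L^\sigma$ norm gives a finite $L^1$ norm, so the extended
function $1/|\rho|$ is finite almost everywhere. -/
theorem ae_ne_zero_of_invNorm_ne_top {ρ : E d → ℝ} (hρ : Continuous ρ) {σ : ℝ≥0∞} (hσ : 1 ≤ σ)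
    (h : invNorm ρ σ ≠ ⊤) : ∀ᵐ x ∂(torus d), ρ x ≠ 0 := by
  have hm : Measurable fun x => (‖ρ x‖ₑ)⁻¹ := by fun_prop
  have h1 := (eLpNorm_le_eLpNorm_of_exponent_le hσ
    hm.stronglyMeasurable.aestronglyMeasurable).trans_lt (lt_top_iff_ne_top.2 h)
  rw [eLpNorm_one_eq_lintegral_enorm] at h1
  filter_upwards [ae_lt_top hm h1.ne] with x hx hx0
  simp [hx0] at hx

/-- Almost everywhere $A\le\nu_*^{-1/p}\,|\rho|^{-\gamma/p}\,\nu(\rho)^{1/p}A$. Hölder puts the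
weight in $L^{\sigma p/\gamma}$ and the rest in $L^p$; the definition of $\beta$ is exactly the
exponent relation, also for $\sigma=\infty$. -/
theorem eLpNorm_strain_le {p γ β νs : ℝ} {σ : ℝ≥0∞} (hp : 1 < p) (hγ : 0 < γ) (hσ : 1 ≤ σ)
    (hβ0 : 0 < β) (hβ : 1 / β = (1 / p) * (1 + γ * (σ⁻¹).toReal)) (hνs : 0 < νs)
    {ν : ℝ → ℝ} (hν : Continuous ν) (hν0 : ∀ r, 0 ≤ ν r) {ρ : E d → ℝ} (hρ : Continuous ρ)
    {A : E d → ℝ} (hA : Continuous A) (hA0 : ∀ x, 0 ≤ A x) (hN : invNorm ρ σ ≠ ⊤)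
    (hlow : ∀ᵐ x ∂(torus d), νs * |ρ x| ^ γ ≤ ν (ρ x)) :
    eLpNorm A (ENNReal.ofReal β) (torus d) ≤ ENNReal.ofReal (νs⁻¹ ^ (1 / p)) *
      (invNorm ρ σ ^ (γ / p) *
        (∫⁻ x, ENNReal.ofReal (ν (ρ x) * A x ^ p) ∂(torus d)) ^ (1 / p)) := by
  have hp0 : 0 < p := by linarith
  have hσ0 : σ ≠ 0 := (zero_lt_one.trans_le hσ).ne'
  -- The real inverse is $0$ at zeros of `ρ`, whereas `invNorm` uses $\infty$ there. This is
  -- harmless: the zeros are null, and the real version is the smaller one.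
  set a : E d → ℝ := fun x => ‖(ρ x)⁻¹‖ ^ (γ / p) with ha
  set W : E d → ℝ := fun x => ν (ρ x) ^ (1 / p) * A x with hW
  have hW0 : ∀ x, 0 ≤ W x := fun x => mul_nonneg (Real.rpow_nonneg (hν0 _) _) (hA0 x)
  have hWm : Measurable W := by
    have := hν.comp hρ
    exact (Continuous.measurable this).pow_const _ |>.mul hA.measurable
  have ham : Measurable a := by fun_prop
  set r : ℝ≥0∞ := σ * ENNReal.ofReal (p / γ) with hr
  have hrσ : r * ENNReal.ofReal (γ / p) = σ := by
    rw [hr, mul_assoc, ← ENNReal.ofReal_mul (by positivity), div_mul_div_cancel₀ hγ.ne',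
      div_self hp0.ne', ENNReal.ofReal_one, mul_one]
  have htriple : r.HolderTriple (ENNReal.ofReal p) (ENNReal.ofReal β) := by
    refine ⟨?_⟩
    have hσi : σ⁻¹ = ENNReal.ofReal (σ⁻¹).toReal :=
      (ENNReal.ofReal_toReal (ENNReal.inv_ne_top.2 hσ0)).symm
    rw [hr, ENNReal.mul_inv (Or.inl hσ0) (Or.inr (by simpa using div_pos hp0 hγ)),
      ← ENNReal.ofReal_inv_of_pos (div_pos hp0 hγ), ← ENNReal.ofReal_inv_of_pos hp0,
      ← ENNReal.ofReal_inv_of_pos hβ0, hσi, ← ENNReal.ofReal_mul ENNReal.toReal_nonneg,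
      ← ENNReal.ofReal_add (by positivity) (by positivity)]
    congr 1
    rw [← one_div β, hβ]
    simp only [inv_div]
    field_simp
    ring
  have h1 : eLpNorm A (ENNReal.ofReal β) (torus d) ≤
      ENNReal.ofReal (νs⁻¹ ^ (1 / p)) * eLpNorm (a • W) (ENNReal.ofReal β) (torus d) := by
    refine eLpNorm_le_mul_eLpNorm_of_ae_le_mul ?_ _
    filter_upwards [hlow, ae_ne_zero_of_invNorm_ne_top hρ hσ hN] with x hx hx0
    have hρx : 0 < |ρ x| := abs_pos.2 hx0
    have hax : a x = (|ρ x| ^ (γ / p))⁻¹ := by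
      simp only [ha, Real.norm_eq_abs, abs_inv]
      exact Real.inv_rpow hρx.le _
    have ha0 : 0 ≤ a x := by positivity
    rw [Real.norm_of_nonneg (hA0 x), Pi.smul_apply', smul_eq_mul,
      Real.norm_of_nonneg (mul_nonneg ha0 (hW0 x))]
    have h2 : νs ^ (1 / p) * |ρ x| ^ (γ / p) ≤ ν (ρ x) ^ (1 / p) := by
      have := Real.rpow_le_rpow (by positivity) hx (by positivity : 0 ≤ 1 / p)
      rwa [Real.mul_rpow hνs.le (by positivity), ← Real.rpow_mul hρx.le, mul_one_div] at this
    have h3 : 1 ≤ νs⁻¹ ^ (1 / p) * (a x * ν (ρ x) ^ (1 / p)) := by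
      rw [hax, Real.inv_rpow hνs.le, ← mul_assoc, ← mul_inv, ← div_eq_inv_mul,
        le_div_iff₀ (by positivity), one_mul]
      exact h2
    calc A x ≤ νs⁻¹ ^ (1 / p) * (a x * ν (ρ x) ^ (1 / p)) * A x :=
          le_mul_of_one_le_left (hA0 x) h3
      _ = _ := by simp only [hW]; ring
  have h2 : eLpNorm a r (torus d) ≤ invNorm ρ σ ^ (γ / p) := by
    rw [ha, eLpNorm_norm_rpow _ (div_pos hγ hp0), hrσ]
    refine ENNReal.rpow_le_rpow (eLpNorm_mono_enorm fun x => ?_) (by positivity)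
    rcases eq_or_ne (ρ x) 0 with h | h
    · simp [h]
    · rw [enorm_inv h]; exact le_rfl
  have h3 : eLpNorm W (ENNReal.ofReal p) (torus d) =
      (∫⁻ x, ENNReal.ofReal (ν (ρ x) * A x ^ p) ∂(torus d)) ^ (1 / p) := by
    rw [eLpNorm_eq_lintegral_rpow_enorm_toReal (by simpa using hp0) ENNReal.ofReal_ne_top,
      ENNReal.toReal_ofReal hp0.le]
    congr 1
    refine lintegral_congr fun x => ?_
    rw [Real.enorm_of_nonneg (hW0 x), ENNReal.ofReal_rpow_of_nonneg (hW0 x) hp0.le]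
    simp only [hW]
    rw [Real.mul_rpow (Real.rpow_nonneg (hν0 _) _) (hA0 x), ← Real.rpow_mul (hν0 _),
      one_div_mul_cancel hp0.ne', Real.rpow_one]
  refine h1.trans (mul_le_mul_right ?_ _)
  rw [← h3]
  exact (eLpNorm_smul_le_mul_eLpNorm hWm.aestronglyMeasurable ham.aestronglyMeasurable).trans
    (mul_le_mul_left h2 _)

/-- Absorption of the unknown in the energy estimate. -/
theorem le_of_le_mul_rpow {p γ x c n r : ℝ} (hp : 1 < p) (hx : 0 ≤ x) (hc : 0 ≤ c)
    (hn : 0 ≤ n) (hr : 0 ≤ r) (h : x ≤ n ^ (γ / p) * (c * r * x) ^ (1 / p)) :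
    x ≤ c ^ (1 / (p - 1)) * n ^ (γ / (p - 1)) * r ^ (1 / (p - 1)) := by
  have hp0 : 0 < p := by linarith
  have hp1 : 0 < p - 1 := by linarith
  rcases hx.eq_or_lt with hx0 | hx0
  · rw [← hx0]; positivity
  have h1 : x ^ p ≤ n ^ γ * (c * r * x) := by
    have := Real.rpow_le_rpow hx h hp0.le
    rwa [Real.mul_rpow (by positivity) (by positivity), ← Real.rpow_mul hn,
      ← Real.rpow_mul (by positivity), div_mul_cancel₀ _ hp0.ne', one_div_mul_cancel hp0.ne',
      Real.rpow_one] at this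
  -- One power of `x` is divided out; $p>1$ leaves a positive exponent to invert.
  have h2 : x ^ (p - 1) ≤ c * n ^ γ * r := by
    rw [Real.rpow_sub_one hx0.ne', div_le_iff₀ hx0]
    linarith
  have h3 := Real.rpow_le_rpow (by positivity) h2 (by positivity : 0 ≤ 1 / (p - 1))
  rwa [← Real.rpow_mul hx, mul_one_div_cancel hp1.ne', Real.rpow_one,
    Real.mul_rpow (by positivity) hr, Real.mul_rpow hc (by positivity), ← Real.rpow_mul hn,
    mul_one_div] at h3

theorem le_of_le_mul_rpow_ennreal {p γ νs G K : ℝ} {X N R : ℝ≥0∞} (hp : 1 < p) (hγ : 0 < γ)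
    (hνs : 0 < νs) (hG : 0 ≤ G) (hK : 0 ≤ K) (hX : X ≠ ⊤) (hN : N ≠ ⊤) (hR : R ≠ ⊤)
    (h : X ≤ ENNReal.ofReal (νs⁻¹ ^ (1 / p)) * (N ^ (γ / p) *
      (ENNReal.ofReal G * (R * (ENNReal.ofReal K * X))) ^ (1 / p))) :
    X ≤ ENNReal.ofReal ((νs⁻¹ * (G * K)) ^ (1 / (p - 1))) * N ^ (γ / (p - 1)) *
      R ^ (1 / (p - 1)) := by
  have hp0 : 0 < p := by linarith
  have hp1 : 0 < p - 1 := by linarith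
  lift X to NNReal using hX
  lift N to NNReal using hN
  lift R to NNReal using hR
  simp only [← ENNReal.ofReal_coe_nnreal] at h ⊢
  have hγp : 0 ≤ γ / p := by positivity
  have hγp1 : 0 ≤ γ / (p - 1) := by positivity
  rw [ENNReal.ofReal_rpow_of_nonneg N.coe_nonneg hγp, ← ENNReal.ofReal_mul hK, ← ENNReal.ofReal_mul R.coe_nonneg,
    ← ENNReal.ofReal_mul hG, ENNReal.ofReal_rpow_of_nonneg (by positivity) (by positivity),
    ← ENNReal.ofReal_mul (by positivity), ← ENNReal.ofReal_mul (by positivity),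
    ENNReal.ofReal_le_ofReal_iff (by positivity)] at h
  rw [ENNReal.ofReal_rpow_of_nonneg N.coe_nonneg hγp1, ENNReal.ofReal_rpow_of_nonneg R.coe_nonneg (by positivity),
    ← ENNReal.ofReal_mul (by positivity), ← ENNReal.ofReal_mul (by positivity)]
  refine ENNReal.ofReal_le_ofReal (le_of_le_mul_rpow hp X.coe_nonneg (by positivity) N.coe_nonneg R.coe_nonneg
    (h.trans_eq ?_))
  rw [mul_left_comm, ← Real.mul_rpow (by positivity) (by positivity)]
  congr 2
  ring

end StokesTransport

/-! ### Choice of exponents and conclusion -/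

theorem proposition2p1 (d : ℕ) (hd : 2 ≤ d) (p q q' γ β : ℝ) (σ : ℝ≥0∞)
    (hp : 1 < p) (hγ : 0 < γ) (hq : 1 < q) (hq2 : q < 2) (hσ : 1 ≤ σ)
    (hq' : 1 / q + 1 / q' = 1)
    (hβ : 1 / β = (1 / p) * (1 + γ * (σ⁻¹).toReal))
    (hcond :
      (1 / p) * (1 + γ * (σ⁻¹).toReal) + 1 / q - 1 / (d : ℝ) < 1 ∨
      ((1 / p) * (1 + γ * (σ⁻¹).toReal) + 1 / q - 1 / (d : ℝ) = 1 ∧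
        2 * (d : ℝ) / ((d : ℝ) + 2) ≤ q)) :
    1 < β ∧
    ∃ C₀ : ℝ, ∀ (νs : ℝ) (g : E d), 0 < νs → ∃ C : ℝ,
      ∀ (ν : ℝ → ℝ) (ρ₀ : E d → ℝ) (ρ : ℝ → E d → ℝ)
        (u : ℝ → E d → E d) (π : ℝ → E d → ℝ),
        Continuous ν → (∀ r, 0 ≤ ν r) →
        IsSmoothSolution p ν g ρ₀ ρ u π →
        (∀ t, 0 ≤ t →
          eLpNorm (ρ t) (ENNReal.ofReal q) (torus d)
            ≤ eLpNorm ρ₀ (ENNReal.ofReal q) (torus d)) ∧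
        ((∀ x, νs * |ρ₀ x| ^ γ ≤ ν (ρ₀ x)) → invNorm ρ₀ σ ≠ ⊤ →
          ∀ t, 0 ≤ t →
            eLpNorm (fun x => matNorm (strain (u t) x))
                (ENNReal.ofReal β) (torus d)
              ≤ ENNReal.ofReal C * invNorm ρ₀ σ ^ (γ / (p - 1))
                * eLpNorm ρ₀ (ENNReal.ofReal q) (torus d) ^ (1 / (p - 1))) ∧
        (∀ t, 0 ≤ t →
          eLpNorm (u t) (ENNReal.ofReal q') (torus d)
            ≤ ENNReal.ofReal C₀ *
              eLpNorm (fun x => matNorm (strain (u t) x))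
                (ENNReal.ofReal β) (torus d)) := by
  have hd' : (2 : ℝ) ≤ d := by exact_mod_cast hd
  have hp0 : 0 < p := by linarith
  have hq0 : 0 < q := by linarith
  have hβpos : 0 < 1 / β := by rw [hβ]; positivity
  have hβ0 : 0 < β := one_div_pos.1 hβpos
  have hle : 1 / β ≤ 1 + 1 / (d : ℝ) - 1 / q := by
    rw [hβ]
    rcases hcond with h | h
    · linarith
    · linarith [h.1]
  -- Since $q<2\le d$; this forces both `β` and the Sobolev exponent `b` to exceed $1$.
  have hdq : 1 / (d : ℝ) < 1 / q := one_div_lt_one_div_of_lt hq0 (by linarith)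
  have hβ1 : 1 < β := by
    have : 1 / β < 1 := by linarith
    rwa [div_lt_one hβ0] at this
  refine ⟨hβ1, ?_⟩
  -- The exponent for which Korn–Sobolev is scale invariant. As $b\le\beta$ and the torus has
  -- measure one, the $L^b$ norm of the strain is at most its $L^\beta$ norm, at no cost in the
  -- constant.
  set b : ℝ := 1 / (1 + 1 / (d : ℝ) - 1 / q) with hb
  have hden : 0 < 1 + 1 / (d : ℝ) - 1 / q := hβpos.trans_le hle
  have hb1 : 1 < b := by rw [hb, lt_div_iff₀ hden]; linarith
  have hbs : 1 / b + 1 / q = 1 + 1 / (d : ℝ) := by rw [hb, one_div_one_div]; ring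
  have hbβ : b ≤ β := by
    rw [hb, ← one_div_one_div β]
    exact one_div_le_one_div_of_le hβpos hle
  have hconj : q.HolderConjugate q' := by
    rw [Real.holderConjugate_iff]
    exact ⟨hq, by simpa using hq'⟩
  refine ⟨kornConst d b q, fun νs g hνs =>
    ⟨(νs⁻¹ * (‖g‖ * kornConst d b q)) ^ (1 / (p - 1)), ?_⟩⟩
  intro ν ρ₀ ρ u π hν hν0 hsol
  have hkorn : ∀ t, 0 ≤ t → eLpNorm (u t) (ENNReal.ofReal q') (torus d) ≤
      ENNReal.ofReal (kornConst d b q) *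
        eLpNorm (fun x => matNorm (strain (u t) x)) (ENNReal.ofReal β) (torus d) := by
    intro t ht
    have hu : ContDiff ℝ 1 (u t) := (hsol.smooth_velocity.contDiff ht).of_le (by simp)
    refine (korn_sobolev hd hb1 hq hq' hbs hu (hsol.periodic_velocity t ht)
      (hsol.mean_zero t ht)).trans (mul_le_mul_right ?_ _)
    exact eLpNorm_le_eLpNorm_of_exponent_le (ENNReal.ofReal_le_ofReal hbβ)
      (continuous_matNorm_strain hu).aestronglyMeasurable
  refine ⟨fun t ht => (hsol.eLpNorm_density ht _).le, fun hlow hN t ht => ?_, hkorn⟩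
  have hu := hsol.smooth_velocity.contDiff ht
  have hu1 : ContDiff ℝ 1 (u t) := hu.of_le (by simp)
  have hρ : Continuous (ρ t) := (hsol.smooth_density.contDiff ht).continuous
  have hρ0 : Continuous ρ₀ := hsol.initial ▸ (hsol.smooth_density.contDiff le_rfl).continuous
  have hA := continuous_matNorm_strain hu1
  have hlow' : ∀ᵐ x ∂(torus d), νs * |ρ t x| ^ γ ≤ ν (ρ t x) := by
    refine hsol.ae_density ht (P := fun r => νs * |r| ^ γ ≤ ν r) ?_
      (Filter.Eventually.of_forall hlow)
    exact measurableSet_le (by fun_prop) hν.measurable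
  have h1 := eLpNorm_strain_le hp hγ hσ hβ0 hβ hνs hν hν0 hρ hA (fun x => matNorm_nonneg _)
    (by rwa [hsol.invNorm_density ht]) hlow'
  have h2 := (hsol.stokes t ht).energy_le hp hconj hν hν0 hρ hu
    (hsol.smooth_pressure.contDiff ht) (hsol.periodic_velocity t ht)
    (hsol.periodic_pressure_gradient t ht) (hsol.div_free t ht) (hsol.mean_zero t ht)
  rw [hsol.invNorm_density ht] at h1
  rw [hsol.eLpNorm_density ht] at h2
  refine le_of_le_mul_rpow_ennreal hp hγ hνs (norm_nonneg g) (kornConst_nonneg _ _ _)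
    (hA.memLp_torus _).eLpNorm_ne_top hN (hρ0.memLp_torus _).eLpNorm_ne_top
    (h1.trans (mul_le_mul_right (mul_le_mul_right
      (ENNReal.rpow_le_rpow (h2.trans ?_) (by positivity)) _) _))
  exact mul_le_mul_right (mul_le_mul_right (hkorn t ht) _) _
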